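/- For sets $D,S$ of positive integers, the distance game with sets $D,S$ is the following game on a finite simple graph $G$. The players Left and Right alternately place a piece of their own colour on an empty vertex, such that at no time two pieces of different players are at graph distance $d$ with $d\in D$, and no two pieces of the same player are at graph distance $s$ with $s\in S$; pieces are never moved or removed, and the last player to move wins. A position consists of a finite graph and a partial placement of pieces obeying these rules. The game is called PSPACE-hard if the following decision problem is PSPACE-hard (under polynomial-time many-one reductions): given a position, encoded by the adjacency matrix and the contents of the vertices, and the player who moves next, does that player have a winning strategy? The game $\mathrm{Col}$ is the distance game with $D=\varnothing$ and $S=\{1\}$. **Proposition.** If $\mathrm{Col}$ is PSPACE-hard, then for every integer $k\ge 1$ the distance game with $D=\varnothing$ and $S=\{1,2,\dots,k\}$ is PSPACE-hard. -/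

import Mathlib

/-! ### Polynomial space and hardness for it -/

namespace Complexity

open Turing

open Classical in
/-- A language over `{0,1}` belongs to PSPACE if some multi-stack Turing machine, started with the
input `x` on its input stack and with all other stacks empty, always halts, leaves the single bit
`[x ∈ L]` on its output stack, and in every configuration reached on the way has at most `p(|x|)`
symbols on each of its finitely many stacks, for a fixed polynomial `p`. -/
def InPSPACE (L : Set (List Bool)) : Prop :=
  ∃ (M : TM2ComputableAux Bool Bool) (p : Polynomial ℕ), ∀ x : List Bool,
    Nonempty (TM2Outputs M.tm (x.map M.inputAlphabet.invFun)
      (some ([decide (x ∈ L)].map M.outputAlphabet.invFun))) ∧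
    ∀ cfg : M.tm.Cfg,
      StateTransition.Reaches M.tm.step (initList M.tm (x.map M.inputAlphabet.invFun)) cfg →
      ∀ k : M.tm.K, (cfg.stk k).length ≤ p.eval x.length

/-- A decision problem consists of a type `α` of instances, written down as words by `enc`, and the
set `Yes` of its yes-instances. It is PSPACE-hard if every language in PSPACE has a polynomial-time
many-one reduction to it. -/
def PSPACEHard {α Γ : Type} (enc : α → List Γ) (Yes : Set α) : Prop :=
  ∀ L : Set (List Bool), InPSPACE L →
    ∃ f : List Bool → α,
      Nonempty (TM2ComputableInPolyTime (id : List Bool → List Bool) enc f) ∧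
      ∀ x, x ∈ L ↔ f x ∈ Yes

end Complexity

/-! ### Distance games -/

namespace DistanceGame

/-- The two players; a piece is identified with the player who owns it. -/
inductive Player
  | left
  | right
  deriving DecidableEq

instance : Fintype Player where
  elems := {Player.left, Player.right}
  complete p := by cases p <;> simp

/-- The opponent of a player. -/
def Player.other : Player → Player
  | .left => .right
  | .right => .left

section Rules

variable {V : Type} (D S : Set ℕ) (G : SimpleGraph V)

/-- A partial colouring of the vertices (`none` is an empty vertex) obeys the rules if two pieces of
different players never have a distance in `D`, and two pieces of the same player never have a
distance in `S`. Vertices in different components have distance `⊤`, which lies in neither set. -/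
def Legal (c : V → Option Player) : Prop :=
  ∀ u v : V, u ≠ v → ∀ p q : Player, c u = some p → c v = some q →
    (p ≠ q → ∀ d ∈ D, G.edist u v ≠ (d : ℕ∞)) ∧
    (p = q → ∀ s ∈ S, G.edist u v ≠ (s : ℕ∞))

open Classical in
/-- The player `p` can move from `c` to `c'`: `c'` arises from `c` by placing a piece of `p` on an
empty vertex, and obeys the rules. -/
def IsMove (p : Player) (c c' : V → Option Player) : Prop :=
  ∃ v : V, c v = none ∧ c' = Function.update c v (some p) ∧ Legal D S G c'

/-- The player `p`, moving next from `c`, has a winning strategy under normal play (the last player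
to move wins): `p` has a move such that after each reply of the opponent `p`, again moving next,
has a winning strategy. -/
inductive MoverWins (p : Player) : (V → Option Player) → Prop
  | intro (c c' : V → Option Player) (move : IsMove D S G p c c')
      (replies : ∀ c'', IsMove D S G p.other c' c'' → MoverWins p c'') : MoverWins p c

end Rules

/-- An instance of the decision problem of the distance game with distance sets `D` and `S`: a
position of the game (a finite graph and a placement of pieces that obeys the rules), together with
the player who moves next. -/
structure Instance (D S : Set ℕ) where
  /-- the number of vertices -/
  n : ℕ
  /-- the board -/
  graph : SimpleGraph (Fin n)
  /-- the pieces placed so far -/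
  colour : Fin n → Option Player
  /-- the pieces obey the rules -/
  legal : Legal D S graph colour
  /-- the player to move -/
  turn : Player

/-- The alphabet in which instances are written. -/
inductive Letter
  | turn (p : Player)
  | cell (c : Option Player)
  | entry (b : Bool)
  deriving DecidableEq, Fintype

open Classical in
/-- An instance is written as the player to move, then the contents of the vertices, then the
adjacency matrix of the graph row by row. -/
noncomputable def Instance.encode {D S : Set ℕ} (I : Instance D S) : List Letter :=
  Letter.turn I.turn ::
    (List.ofFn (fun i => Letter.cell (I.colour i)) ++
      (List.ofFn (fun i =>
        List.ofFn (fun j => Letter.entry (decide (I.graph.Adj i j))))).flatten)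

/-- Different instances are written as different words. -/
theorem Instance.encode_injective (D S : Set ℕ) :
    Function.Injective (Instance.encode (D := D) (S := S)) := by
  classical
  rintro ⟨n, G, c, hc, t⟩ ⟨m, H, d, hd, u⟩ h
  have key : ∀ I : Instance D S,
      (I.encode.filterMap fun l => match l with | .cell x => some x | _ => none)
        = List.ofFn I.colour := by
    intro I
    simp only [Instance.encode, List.filterMap_cons, List.filterMap_append, List.filterMap_flatten]
    have h1 : (List.ofFn fun i => Letter.cell (I.colour i)) = (List.ofFn I.colour).map Letter.cell := by
      simp [List.map_ofFn, Function.comp_def]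
    rw [h1, List.filterMap_map]
    simp [Function.comp_def, List.filterMap_eq_nil_iff, List.mem_ofFn]
  have hcol := (key _).symm.trans ((congrArg _ h).trans (key _))
  have hn : n = m := by simpa using congrArg List.length hcol
  subst hn
  have hcd : c = d := List.ofFn_injective hcol
  subst hcd
  simp only [Instance.encode, List.cons.injEq, Letter.turn.injEq, List.append_cancel_left_eq] at h
  obtain ⟨rfl, h⟩ := h
  have hrows : (List.ofFn fun i => List.ofFn fun j => Letter.entry (decide (G.Adj i j)))
      = List.ofFn fun i => List.ofFn fun j => Letter.entry (decide (H.Adj i j)) := by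
    refine List.eq_iff_flatten_eq.2 ⟨h, ?_⟩
    simp [List.map_ofFn, Function.comp_def]
  have hG : G = H := by
    ext i j
    have := congrFun (List.ofFn_injective (congrFun (List.ofFn_injective hrows) i)) j
    simpa using this
  subst hG
  rfl

/-- The decision problem of a distance game: can the player to move force a win? -/
def winning (D S : Set ℕ) : Set (Instance D S) :=
  {I | MoverWins D S I.graph I.turn I.colour}

/-- The ruleset with distance sets `D` and `S` is PSPACE-hard if deciding whether the next player
has a winning strategy in a given position is. -/
def IsPSPACEHard (D S : Set ℕ) : Prop :=
  Complexity.PSPACEHard (Instance.encode (D := D) (S := S)) (winning D S)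

end DistanceGame

/-!
For `k = 1` there is nothing to show. For `k ≥ 2` the problem Col is reduced to the game with
`D = ∅` and `S = {1, …, k}`; composing with the reduction turns every polynomial-time many-one
reduction to Col into one to the new game.

*The board* (`board`). Write `k = q + b + 1` with `b + 1 ≤ q ≤ b + 2`. Each vertex `u` of the old
graph becomes a tail, a path `pt u 0, …, pt u b`, whose outer end stands for `u`. Each ordered pair
`(u, v)` gets a vertex `mid u v`, joined to the inner end of the tail of `u`, and to that of `v` if
`u` and `v` are adjacent. All vertices `mid u v` are joined to one end of a path, the hub, whose
other end is doubled and carries a piece of each player. The board is graded by the distance from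
these two pieces (`Vtx.level`): the outer ends of the tails have level `k + 1`, all other empty
vertices a level between `1` and `k`. So no player can ever move to any vertex except the outer ends
(`eq_pt_of_legal`), and there the two pieces do not matter. The outer ends of `u` and `v` have
distance at most `2 * b + 2 ≤ k` if `u` and `v` are adjacent (`edist_pt_le`), and at least
`2 * b + 4 > k` if `u ≠ v` are not, because the function `Vtx.far` increases by at most one along an
edge. Hence the play on the new board is the play of Col on the old graph (`moverWins_place`).

*The machine.* Polynomial-time computability refers to multi-stack Turing machines, so a machine has
to be built. A small language of structured stack programs (`Prog`) with a timed semantics (`Exec`)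
is compiled to machine code that can be placed behind an arbitrary machine (`comp_program`): the
output of that machine, whose length is polynomially bounded since its stacks grow at most linearly
in time, is moved to the input stack of the program. In this language a loop variable ranging over
the vertices of the old graph is a pair of stacks holding the cells before and after the current
vertex (`computes_forVertex`), and two tests suffice: whether two variables have the same value
(`computes_ifEq`), and whether their values are adjacent (`computes_ifAdj`). Nested loops then write
the new adjacency matrix entry by entry (`computes_writeMatrix`), in time polynomial in the number
of vertices.
-/

/-! ### Stack programs -/

namespace StackProgram

open Turing StateTransition Function

/-- A structured program acting on stacks indexed by `K`, all over the alphabet `A`. -/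
inductive Prog (K A : Type)
  /-- do nothing -/
  | skip
  /-- push a letter -/
  | push (k : K) (a : A)
  /-- run two programs in sequence -/
  | seq (p q : Prog K A)
  /-- pop a stack, and continue according to the letter found (`none` if the stack is empty) -/
  | case (k : K) (p : Option A → Prog K A)
  /-- pop a stack until it is found empty, running a program after each letter -/
  | loop (k : K) (p : A → Prog K A)

variable {K A : Type}

section Semantics

variable [DecidableEq K]

/-- `Exec p s s' t`: the program `p`, started with stack contents `s`, terminates with stack
contents `s'` after at most `t` steps. -/
inductive Exec : Prog K A → (K → List A) → (K → List A) → ℕ → Prop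
  | skip (s) : Exec .skip s s 1
  | push (k a s) : Exec (.push k a) s (update s k (a :: s k)) 1
  | seq {p q s s' s'' t u} : Exec p s s' t → Exec q s' s'' u → Exec (.seq p q) s s'' (t + u)
  | case {k p s s' t} : Exec (p (s k).head?) (update s k (s k).tail) s' t →
      Exec (.case k p) s s' (t + 1)
  | loop_nil {k p s} : s k = [] → Exec (.loop k p) s s 1
  | loop_cons {k p s s' s'' a l t u} : s k = a :: l → Exec (p a) (update s k l) s' t →
      Exec (.loop k p) s' s'' u → Exec (.loop k p) s s'' (t + u + 1)
  | weaken {p s s' t u} : Exec p s s' t → t ≤ u → Exec p s s' u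

end Semantics

/-! ### Compilation of stack programs to Turing machines -/

/-- The labels of the compiled program. -/
def Prog.Lab : Prog K A → Type
  | .skip => Unit
  | .push _ _ => Unit
  | .seq p q => p.Lab ⊕ q.Lab
  | .case _ p => Option (Σ o : Option A, (p o).Lab)
  | .loop _ p => Option (Σ a : A, (p a).Lab)

theorem Prog.finite_lab [Finite A] : ∀ p : Prog K A, Finite p.Lab
  | .skip => inferInstanceAs (Finite Unit)
  | .push _ _ => inferInstanceAs (Finite Unit)
  | .seq p q =>
    have := p.finite_lab
    have := q.finite_lab
    inferInstanceAs (Finite (p.Lab ⊕ q.Lab))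
  | .case _ p =>
    have := fun o => (p o).finite_lab
    inferInstanceAs (Finite (Option (Σ o : Option A, (p o).Lab)))
  | .loop _ p =>
    have := fun a => (p a).finite_lab
    inferInstanceAs (Finite (Option (Σ a : A, (p a).Lab)))

/-- The label at which the compiled program is entered. -/
def Prog.entry : (p : Prog K A) → p.Lab
  | .skip => ()
  | .push _ _ => ()
  | .seq p _ => .inl p.entry
  | .case _ _ => none
  | .loop _ _ => none

/-- The stack alphabets of a machine that has the stacks of another machine (with alphabets `Γ₁`)
next to the stacks of a program. -/
@[reducible]
def JoinΓ {K₁ : Type} (Γ₁ : K₁ → Type) (K A : Type) : K₁ ⊕ K → Type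
  | .inl k => Γ₁ k
  | .inr _ => A

/-- The stack contents of both groups of stacks together. -/
def join {K₁ : Type} {Γ₁ : K₁ → Type} (S : ∀ k, List (Γ₁ k)) (s : K → List A) :
    ∀ k, List (JoinΓ Γ₁ K A k)
  | .inl k => S k
  | .inr k => s k

section Compile

variable {K₁ : Type} {Γ₁ : K₁ → Type} {σ₁ : Type} {Λ : Type}

/-- The code of a program inside a machine with further stacks, states and labels. The letter
popped last is kept in the second component of the state; `emb` places the labels of the program
among those of the machine, and `exit` is the label at which the machine continues. -/
def Prog.code : (p : Prog K A) → (emb : p.Lab → Λ) → (exit : Λ) → p.Lab →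
    TM2.Stmt (JoinΓ Γ₁ K A) Λ (σ₁ × Option A)
  | .skip, _, exit, _ => .goto fun _ => exit
  | .push k a, _, exit, _ => .push (.inr k) (fun _ => a) (.goto fun _ => exit)
  | .seq p q, emb, exit, x =>
    match x with
    | .inl y => p.code (emb ∘ .inl) (emb (.inr q.entry)) y
    | .inr y => q.code (emb ∘ .inr) exit y
  | .case k p, emb, exit, x =>
    match x with
    | none => .pop (.inr k) (fun v o => (v.1, o)) (.goto fun v => emb (some ⟨v.2, (p v.2).entry⟩))
    | some ⟨o, y⟩ => (p o).code (fun z => emb (some ⟨o, z⟩)) exit y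
  | .loop k p, emb, exit, x =>
    match x with
    | none => .pop (.inr k) (fun v o => (v.1, o))
        (.goto fun v => v.2.elim exit fun a => emb (some ⟨a, (p a).entry⟩))
    | some ⟨a, y⟩ => (p a).code (fun z => emb (some ⟨a, z⟩)) (emb none) y

end Compile

/-- `RunsIn f t a b`: iterating the partial function `f` leads from `a` to `b` in at most `t`
steps. -/
def RunsIn {C : Type} (f : C → Option C) (t : ℕ) (a b : C) : Prop :=
  ∃ n ≤ t, (flip bind f)^[n] (some a) = some b

theorem RunsIn.refl {C : Type} (f : C → Option C) (a : C) : RunsIn f 0 a a :=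
  ⟨0, le_rfl, rfl⟩

theorem RunsIn.trans {C : Type} {f : C → Option C} {t u : ℕ} {a b c : C} (h : RunsIn f t a b)
    (h' : RunsIn f u b c) : RunsIn f (t + u) a c := by
  obtain ⟨n, hn, e⟩ := h
  obtain ⟨m, hm, e'⟩ := h'
  exact ⟨m + n, by omega, by rw [iterate_add_apply, e, e']⟩

theorem RunsIn.mono {C : Type} {f : C → Option C} {t u : ℕ} {a b : C} (h : RunsIn f t a b)
    (htu : t ≤ u) : RunsIn f u a b :=
  h.imp fun _ hn => ⟨hn.1.trans htu, hn.2⟩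

theorem RunsIn.single {C : Type} {f : C → Option C} {a b : C} (h : f a = some b) :
    RunsIn f 1 a b :=
  ⟨1, le_rfl, h⟩

theorem RunsIn.head {C : Type} {f : C → Option C} {t : ℕ} {a b c : C} (h : f a = some b)
    (h' : RunsIn f t b c) : RunsIn f (t + 1) a c :=
  ((RunsIn.single h).trans h').mono (by omega)

section Simulation

variable [DecidableEq K] {K₁ : Type} [DecidableEq K₁] {Γ₁ : K₁ → Type} {σ₁ : Type} {Λ : Type}

theorem update_join_inr (S : ∀ k, List (Γ₁ k)) (s : K → List A) (k : K) (l : List A) :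
    update (join S s) (.inr k) l = join S (update s k l) := by
  funext x
  rcases x with x | x
  · rw [update_of_ne (by simp)]; rfl
  · by_cases h : x = k
    · subst h; simp [join]
    · rw [update_of_ne (by simpa using h)]; simp [join, h]

theorem update_join_inl (S : ∀ k, List (Γ₁ k)) (s : K → List A) (k : K₁) (l : List (Γ₁ k)) :
    update (join S s) (.inl k) l = join (update S k l) s := by
  funext x
  rcases x with x | x
  · by_cases h : x = k
    · subst h; simp [join]
    · rw [update_of_ne (by simpa using h)]; simp [join, h]
  · rw [update_of_ne (by simp)]; rfl

theorem step_eq {K₂ Λ σ : Type} [DecidableEq K₂] {Γ : K₂ → Type} {M : Λ → TM2.Stmt Γ Λ σ} {l : Λ}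
    {q : TM2.Stmt Γ Λ σ} {v : σ} {S : ∀ k, List (Γ k)} (h : M l = q) :
    TM2.step M ⟨some l, v, S⟩ = some (TM2.stepAux q v S) := by
  rw [TM2.step, h]

theorem stk_congr {K₂ Λ σ : Type} {Γ : K₂ → Type} {l : Option Λ} {v : σ}
    {S S' : ∀ k, List (Γ k)} (h : S = S') :
    some (TM2.Cfg.mk l v S) = some ⟨l, v, S'⟩ := by
  rw [h]

/-- A machine that contains the code of a program follows the execution of the program. -/
theorem Exec.runsIn {M : Λ → TM2.Stmt (JoinΓ Γ₁ K A) Λ (σ₁ × Option A)} {p : Prog K A}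
    {s s' : K → List A} {t : ℕ} (h : Exec p s s' t) :
    ∀ (emb : p.Lab → Λ) (exit : Λ), (∀ x, M (emb x) = p.code emb exit x) →
    ∀ (S : ∀ k, List (Γ₁ k)) (v : σ₁) (o : Option A), ∃ o' : Option A,
      RunsIn (TM2.step M) t ⟨some (emb p.entry), (v, o), join S s⟩
        ⟨some exit, (v, o'), join S s'⟩ := by
  induction h with
  | skip s =>
    intro emb exit hM S v o
    exact ⟨o, RunsIn.single (by simp [hM, Prog.code])⟩
  | push k a s =>
    intro emb exit hM S v o
    refine ⟨o, RunsIn.single ?_⟩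
    exact (step_eq (hM ())).trans (stk_congr (update_join_inr S s k (a :: s k)))
  | @seq p q s s' s'' t u _ _ ih₁ ih₂ =>
    intro emb exit hM S v o
    obtain ⟨o₁, h₁⟩ := ih₁ (emb ∘ .inl) (emb (.inr q.entry)) (fun x => hM (.inl x)) S v o
    obtain ⟨o₂, h₂⟩ := ih₂ (emb ∘ .inr) exit (fun x => hM (.inr x)) S v o₁
    exact ⟨o₂, h₁.trans h₂⟩
  | @case k p s s' t _ ih =>
    intro emb exit hM S v o
    obtain ⟨o', h'⟩ := ih (fun z => emb (some ⟨_, z⟩)) exit (fun x => hM (some ⟨_, x⟩)) S v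
      (s k).head?
    refine ⟨o', RunsIn.head ?_ h'⟩
    exact (step_eq (hM none)).trans (stk_congr (update_join_inr S s k (s k).tail))
  | @loop_nil k p s hs =>
    intro emb exit hM S v o
    refine ⟨none, RunsIn.single ?_⟩
    refine (step_eq (hM none)).trans ?_
    change some (TM2.Cfg.mk (some ((s k).head?.elim exit fun a => emb (some ⟨a, (p a).entry⟩)))
      (v, (s k).head?) (update (join S s) (.inr k) (s k).tail)) = _
    rw [update_join_inr, hs, List.tail_nil, ← hs, update_eq_self, hs]
    rfl
  | @loop_cons k p s s' s'' a l t u hs _ _ ih₁ ih₂ =>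
    intro emb exit hM S v o
    obtain ⟨o₁, h₁⟩ := ih₁ (fun z => emb (some ⟨_, z⟩)) (emb none) (fun x => hM (some ⟨_, x⟩)) S v
      (some a)
    obtain ⟨o₂, h₂⟩ := ih₂ emb exit hM S v o₁
    refine ⟨o₂, RunsIn.head ?_ (h₁.trans h₂)⟩
    refine (step_eq (hM none)).trans ?_
    change some (TM2.Cfg.mk (some ((s k).head?.elim exit fun a => emb (some ⟨a, (p a).entry⟩)))
      (v, (s k).head?) (update (join S s) (.inr k) (s k).tail)) = _
    rw [update_join_inr, hs]
    rfl
  | weaken _ htu ih =>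
    intro emb exit hM S v o
    obtain ⟨o', h'⟩ := ih emb exit hM S v o
    exact ⟨o', h'.mono htu⟩

end Simulation

/-! ### Stack growth of a machine -/

/-- The number of pushes in a statement. -/
def pushCount {K₁ : Type} {Γ₁ : K₁ → Type} {Λ σ : Type} : TM2.Stmt Γ₁ Λ σ → ℕ
  | .push _ _ q => pushCount q + 1
  | .peek _ _ q => pushCount q
  | .pop _ _ q => pushCount q
  | .load _ q => pushCount q
  | .branch _ q₁ q₂ => pushCount q₁ + pushCount q₂
  | .goto _ => 0
  | .halt => 0

theorem length_stepAux_le {K₁ : Type} [DecidableEq K₁] {Γ₁ : K₁ → Type} {Λ σ : Type}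
    (q : TM2.Stmt Γ₁ Λ σ) (v : σ) (S : ∀ k, List (Γ₁ k)) (k : K₁) :
    ((TM2.stepAux q v S).stk k).length ≤ (S k).length + pushCount q := by
  induction q generalizing v S with
  | push k' f q ih =>
    refine (ih v _).trans ?_
    by_cases h : k = k'
    · subst h; simp [pushCount]; omega
    · simp [pushCount, h]
  | peek k' f q ih => exact ih _ _
  | pop k' f q ih =>
    refine (ih _ _).trans ?_
    by_cases h : k = k'
    · subst h; simp [pushCount]
    · simp [pushCount, h]
  | load f q ih => exact ih _ _
  | branch f q₁ q₂ ih₁ ih₂ =>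
    simp only [TM2.stepAux, pushCount]
    cases f v
    · exact (ih₂ v S).trans (by omega)
    · exact (ih₁ v S).trans (by omega)
  | goto f => simp [pushCount]
  | halt => simp [pushCount]

/-- Each stack of a machine grows at most linearly with the number of steps. -/
theorem exists_length_le (tm : FinTM2) : ∃ c : ℕ, ∀ (n : ℕ) (a b : tm.Cfg),
    (flip bind tm.step)^[n] (some a) = some b →
      ∀ k, (b.stk k).length ≤ (a.stk k).length + c * n := by
  have := tm.ΛFin
  refine ⟨∑ l, pushCount (tm.m l), fun n => ?_⟩
  induction n with
  | zero => rintro a b h k; cases h; simp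
  | succ n ih =>
    intro a b h k
    rw [iterate_succ_apply'] at h
    obtain ⟨c, hc, hcb⟩ := Option.bind_eq_some_iff.1 h
    refine le_trans ?_ ((Nat.add_le_add_right (ih a c hc k) _).trans_eq
      (by rw [Nat.mul_succ, add_assoc]))
    obtain ⟨_ | l, v, S⟩ := c
    · simp at hcb
    · obtain rfl : _ = b := Option.some.inj hcb
      exact (length_stepAux_le _ _ _ _).trans (Nat.add_le_add_left
        (Finset.single_le_sum (f := fun l => pushCount (tm.m l)) (fun _ _ => Nat.zero_le _)
          (Finset.mem_univ l)) _)

/-! ### Running a stack program after a machine -/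

section Lift

variable {K₁ : Type} [DecidableEq K₁] {Γ₁ : K₁ → Type} {σ₁ Λ₁ Λ : Type}

/-- A statement of a machine as a statement of a larger machine; halting becomes a jump to
`exit`. -/
def liftStmt (emb : Λ₁ → Λ) (exit : Λ) :
    TM2.Stmt Γ₁ Λ₁ σ₁ → TM2.Stmt (JoinΓ Γ₁ K A) Λ (σ₁ × Option A)
  | .push k f q => .push (.inl k) (fun v => f v.1) (liftStmt emb exit q)
  | .peek k f q => .peek (.inl k) (fun v o => (f v.1 o, v.2)) (liftStmt emb exit q)
  | .pop k f q => .pop (.inl k) (fun v o => (f v.1 o, v.2)) (liftStmt emb exit q)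
  | .load f q => .load (fun v => (f v.1, v.2)) (liftStmt emb exit q)
  | .branch f q₁ q₂ => .branch (fun v => f v.1) (liftStmt emb exit q₁) (liftStmt emb exit q₂)
  | .goto f => .goto fun v => emb (f v.1)
  | .halt => .goto fun _ => exit

/-- A configuration of a machine as a configuration of a larger machine; a halted configuration is
one in which the larger machine continues at `exit`. -/
def liftCfg (emb : Λ₁ → Λ) (exit : Λ) (o : Option A) (s : K → List A) (c : TM2.Cfg Γ₁ Λ₁ σ₁) :
    TM2.Cfg (JoinΓ Γ₁ K A) Λ (σ₁ × Option A) :=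
  ⟨some (c.l.elim exit emb), (c.var, o), join c.stk s⟩

variable [DecidableEq K]

theorem stepAux_liftStmt (emb : Λ₁ → Λ) (exit : Λ) (o : Option A) (s : K → List A)
    (q : TM2.Stmt Γ₁ Λ₁ σ₁) (v : σ₁) (S : ∀ k, List (Γ₁ k)) :
    TM2.stepAux (liftStmt emb exit q) (v, o) (join S s)
      = liftCfg emb exit o s (TM2.stepAux q v S) := by
  induction q generalizing v S with
  | push k f q ih =>
    exact (congrArg (TM2.stepAux (liftStmt emb exit q) (v, o))
      (update_join_inl S s k (f v :: S k))).trans (ih v _)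
  | peek k f q ih => exact ih _ _
  | pop k f q ih =>
    exact (congrArg (TM2.stepAux (liftStmt emb exit q) (f v (S k).head?, o))
      (update_join_inl S s k (S k).tail)).trans (ih _ _)
  | load f q ih => exact ih _ _
  | branch f q₁ q₂ ih₁ ih₂ =>
    simp only [TM2.stepAux, liftStmt]
    cases f v
    · exact ih₂ v S
    · exact ih₁ v S
  | goto f => rfl
  | halt => rfl

/-- The larger machine runs in lockstep with the machine it contains. -/
theorem iterate_step_liftCfg (emb : Λ₁ → Λ) (exit : Λ) (o : Option A) (s : K → List A)
    (m : Λ₁ → TM2.Stmt Γ₁ Λ₁ σ₁) (M : Λ → TM2.Stmt (JoinΓ Γ₁ K A) Λ (σ₁ × Option A))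
    (hM : ∀ l, M (emb l) = liftStmt emb exit (m l)) (n : ℕ) (a b : TM2.Cfg Γ₁ Λ₁ σ₁)
    (h : (flip bind (TM2.step m))^[n] (some a) = some b) :
    (flip bind (TM2.step M))^[n] (some (liftCfg emb exit o s a))
      = some (liftCfg emb exit o s b) := by
  induction n generalizing b with
  | zero => cases h; rfl
  | succ n ih =>
    rw [iterate_succ_apply'] at h ⊢
    obtain ⟨c, hc, hcb⟩ := Option.bind_eq_some_iff.1 h
    rw [ih c hc]
    obtain ⟨_ | l, v, S⟩ := c
    · simp at hcb
    · simp only [TM2.step, Option.some.injEq] at hcb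
      subst hcb
      exact congrArg some (by rw [Option.elim_some, hM]; exact stepAux_liftStmt ..)

end Lift

section Composition

variable [Inhabited A]

/-- The labels of the composite of a machine with a program: those of the machine, one for moving
the output of the machine to the input stack of the program, those of the program, and a last
one. -/
inductive CompLab (Λ₁ Λ₂ : Type)
  | fst (l : Λ₁)
  | move
  | snd (l : Λ₂)
  | done

theorem finite_compLab (Λ₁ Λ₂ : Type) [Finite Λ₁] [Finite Λ₂] : Finite (CompLab Λ₁ Λ₂) := by
  refine Finite.of_injective
    (β := Option (Option (Λ₁ ⊕ Λ₂)))
    (fun | .fst l => some (some (.inl l)) | .move => none | .snd l => some (some (.inr l))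
         | .done => some none) ?_
  rintro (_ | _ | _ | _) (_ | _ | _ | _) h <;> simp_all

/-- The code of the composite of a machine with a program. -/
def compCode (tm : FinTM2) (e : tm.Γ tm.k₁ → A) (p : Prog K A) (kin : K) :
    CompLab tm.Λ p.Lab →
      TM2.Stmt (JoinΓ tm.Γ K A) (CompLab tm.Λ p.Lab) (tm.σ × Option A)
  | .fst l => liftStmt .fst .move (tm.m l)
  | .move => .pop (.inl tm.k₁) (fun v o => (v.1, o.map e))
      (.branch (fun v => v.2.isSome)
        (.push (.inr kin) (fun v => v.2.getD default) (.goto fun _ => .move))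
        (.goto fun _ => .snd p.entry))
  | .snd x => p.code .snd .done x
  | .done => .load (fun _ => (tm.initialState, none)) .halt

/-- The composite of a machine with a program, which finds the output of the machine in reverse
order on its stack `kin` and leaves its own output on its stack `kout`. -/
noncomputable def compMachine [DecidableEq K] [Fintype K] [Fintype A] (tm : FinTM2)
    (e : tm.Γ tm.k₁ → A) (p : Prog K A) (kin kout : K) : FinTM2 :=
  letI := tm.kFin
  letI := tm.ΛFin
  letI := tm.σFin
  letI := tm.Γk₀Fin
  haveI := p.finite_lab
  haveI := finite_compLab tm.Λ p.Lab
  { K := tm.K ⊕ K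
    k₀ := .inl tm.k₀
    k₁ := .inr kout
    Γ := JoinΓ tm.Γ K A
    Λ := CompLab tm.Λ p.Lab
    main := .fst tm.main
    ΛFin := Fintype.ofFinite _
    σ := tm.σ × Option A
    initialState := (tm.initialState, none)
    Γk₀Fin := inferInstanceAs (Fintype (tm.Γ tm.k₀))
    m := compCode tm e p kin }

/-- The output of the machine is moved to the input stack of the program, which reverses it. -/
theorem runsIn_move [DecidableEq K] (tm : FinTM2) (e : tm.Γ tm.k₁ → A) (p : Prog K A) (kin : K)
    (w : List (tm.Γ tm.k₁)) (S : ∀ k, List (tm.Γ k)) (s : K → List A) (v : tm.σ) (o : Option A)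
    (hw : S tm.k₁ = w) :
    RunsIn (TM2.step (compCode tm e p kin)) (w.length + 1)
      ⟨some .move, (v, o), join S s⟩
      ⟨some (.snd p.entry), (v, none),
        join (update S tm.k₁ []) (update s kin ((w.map e).reverse ++ s kin))⟩ := by
  induction w generalizing S s o with
  | nil =>
    rw [show update s kin ((List.map e []).reverse ++ s kin) = s from update_eq_self _ _]
    refine RunsIn.single ?_
    refine (step_eq (M := compCode tm e p kin) (l := .move) rfl).trans ?_
    change some (bif ((S tm.k₁).head?.map e).isSome then _ else
      TM2.Cfg.mk (some (CompLab.snd p.entry)) (v, (S tm.k₁).head?.map e)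
      (update (join S s) (.inl tm.k₁) (S tm.k₁).tail)) = _
    rw [hw]
    exact stk_congr (update_join_inl S s tm.k₁ [])
  | cons a w ih =>
    have h := ih (update S tm.k₁ w) (update s kin (e a :: s kin)) (some (e a)) (by simp)
    rw [update_idem, update_idem, update_self] at h
    rw [List.map_cons, List.reverse_cons, List.append_assoc, List.singleton_append,
      List.length_cons]
    refine RunsIn.head ?_ h
    refine (step_eq (M := compCode tm e p kin) (l := .move) rfl).trans ?_
    change some (bif ((S tm.k₁).head?.map e).isSome then
      TM2.Cfg.mk (some CompLab.move) (v, (S tm.k₁).head?.map e)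
      (update (update (join S s) (.inl tm.k₁) (S tm.k₁).tail) (.inr kin)
        (((S tm.k₁).head?.map e).getD default ::
          update (join S s) (.inl tm.k₁) (S tm.k₁).tail (.inr kin))) else _) = _
    rw [update_join_inl, update_join_inr, hw]
    rfl

end Composition

/-- Evaluation of a polynomial with natural coefficients is monotone. -/
theorem eval_mono (T : Polynomial ℕ) {m n : ℕ} (h : m ≤ n) : T.eval m ≤ T.eval n := by
  rw [Polynomial.eval_eq_sum_range, Polynomial.eval_eq_sum_range]
  gcongr

theorem initList_stk_self (tm : FinTM2) (w : List (tm.Γ tm.k₀)) :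
    (initList tm w).stk tm.k₀ = w := by
  simp [initList]

theorem initList_stk_of_ne (tm : FinTM2) (w : List (tm.Γ tm.k₀)) {k : tm.K} (h : k ≠ tm.k₀) :
    (initList tm w).stk k = [] := by
  simp [initList, h]

theorem haltList_stk_self (tm : FinTM2) (w : List (tm.Γ tm.k₁)) :
    (haltList tm w).stk tm.k₁ = w := by
  simp [haltList]

theorem haltList_stk_of_ne (tm : FinTM2) (w : List (tm.Γ tm.k₁)) {k : tm.K} (h : k ≠ tm.k₁) :
    (haltList tm w).stk k = [] := by
  simp [haltList, h]

section

variable [DecidableEq K] [Fintype K] [Fintype A] [Inhabited A]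

theorem liftCfg_initList (tm : FinTM2) (e : tm.Γ tm.k₁ → A) (p : Prog K A) (kin kout : K)
    (w : List (tm.Γ tm.k₀)) :
    liftCfg CompLab.fst CompLab.move (none : Option A) (fun _ : K => []) (initList tm w)
      = initList (compMachine tm e p kin kout) w := by
  have : join (initList tm w).stk (fun _ : K => ([] : List A))
      = (initList (compMachine tm e p kin kout) w).stk := by
    funext k
    rcases k with k | k
    · by_cases h : k = tm.k₀
      · subst h
        exact (initList_stk_self tm w).trans
          (initList_stk_self (compMachine tm e p kin kout) w).symm
      · exact (initList_stk_of_ne tm w h).trans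
          (initList_stk_of_ne (compMachine tm e p kin kout) w
            (k := .inl k) fun h' => h (Sum.inl.inj h')).symm
    · exact (initList_stk_of_ne (compMachine tm e p kin kout) w
        (k := .inr k) fun h' => Sum.inr_ne_inl h').symm
  exact congrArg (TM2.Cfg.mk (some (CompLab.fst tm.main)) (tm.initialState, none)) this

/-- The configuration in which the composite halts: the first machine has left only its output,
which has been moved away, and the program has left only its own output. -/
theorem mk_eq_haltList (tm : FinTM2) (e : tm.Γ tm.k₁ → A) (p : Prog K A) (kin kout : K)
    (w : List (tm.Γ tm.k₁)) (w' : List A) :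
    TM2.Cfg.mk none (tm.initialState, none)
        (join (update (haltList tm w).stk tm.k₁ []) (update (fun _ => []) kout w'))
      = haltList (compMachine tm e p kin kout) w' := by
  have : join (update (haltList tm w).stk tm.k₁ []) (update (fun _ => []) kout w')
      = (haltList (compMachine tm e p kin kout) w').stk := by
    funext k
    rcases k with k | k
    · refine Eq.trans ?_ (haltList_stk_of_ne (compMachine tm e p kin kout) w'
        (k := .inl k) fun h' => Sum.inl_ne_inr h').symm
      by_cases h : k = tm.k₁
      · subst h
        exact update_self ..
      · exact (update_of_ne h ..).trans (haltList_stk_of_ne tm w h)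
    · by_cases h : k = kout
      · subst h
        change update (fun _ => ([] : List A)) k w' k = _
        rw [update_self]
        exact (haltList_stk_self (compMachine tm e p kin k) w').symm
      · change update (fun _ => ([] : List A)) kout w' k = _
        rw [update_of_ne h]
        exact (haltList_stk_of_ne (compMachine tm e p kin kout) w'
          (k := .inr k) fun h' => h (Sum.inr.inj h')).symm
  exact congrArg (TM2.Cfg.mk none (tm.initialState, none)) this

end

/-- If `f` is computable in polynomial time, and a stack program with polynomially many steps turns
the code of each `b`, written in reverse order on one stack, into the code of `g b`, then `g ∘ f`
is computable in polynomial time. -/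
theorem comp_program [Inhabited A] [Fintype A] [DecidableEq K] [Fintype K] {α β γ αΓ : Type}
    {ea : α → List αΓ} {eb : β → List A} {ec : γ → List A} {f : α → β}
    (hf : TM2ComputableInPolyTime ea eb f) (g : β → γ) (p : Prog K A) (kin kout : K)
    (T : Polynomial ℕ)
    (hp : ∀ b, Exec p (update (fun _ => []) kin (eb b).reverse)
      (update (fun _ => []) kout (ec (g b))) (T.eval (eb b).length)) :
    Nonempty (TM2ComputableInPolyTime ea ec (g ∘ f)) := by
  obtain ⟨⟨tm, ein, eout⟩, time, hout⟩ := hf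
  obtain ⟨c, hc⟩ := exists_length_le tm
  -- a bound for the length of the output of the first machine
  let size : Polynomial ℕ := Polynomial.X + Polynomial.C c * time
  have hlen : ∀ a, (eb (f a)).length ≤ size.eval (ea a).length := by
    intro a
    obtain ⟨⟨n, hn⟩, hle⟩ := hout a
    have := hc n _ _ hn tm.k₁
    have h0 : ((initList tm ((ea a).map ein.invFun)).stk tm.k₁).length ≤ (ea a).length := by
      by_cases h : tm.k₁ = tm.k₀
      · have : ∀ (k : tm.K) (h : k = tm.k₀) (s : List (tm.Γ tm.k₀)),
            ((initList tm s).stk k).length ≤ s.length := by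
          rintro k rfl s
          simp [initList]
        simpa using this _ h ((ea a).map ein.invFun)
      · simp [initList, h]
    have h1 : ((haltList tm ((eb (f a)).map eout.invFun)).stk tm.k₁).length
        = (eb (f a)).length := by
      simp [haltList]
    have h2 : (eb (f a)).length ≤ (ea a).length + c * n :=
      h1.symm.le.trans (this.trans (Nat.add_le_add_right h0 _))
    refine h2.trans ?_
    simp only [size, Polynomial.eval_add, Polynomial.eval_X, Polynomial.eval_mul,
      Polynomial.eval_C]
    exact Nat.add_le_add_left (Nat.mul_le_mul_left c hle) _
  have key : ∀ a, RunsIn (compMachine tm eout p kin kout).step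
      ((time + (size + 1) + T.comp size + 1).eval (ea a).length)
      (initList (compMachine tm eout p kin kout) ((ea a).map ein.invFun))
      (haltList (compMachine tm eout p kin kout) (ec (g (f a)))) := by
    intro a
    obtain ⟨⟨n, hn⟩, hle⟩ := hout a
    have e1 := iterate_step_liftCfg (K := K) (A := A) CompLab.fst CompLab.move none (fun _ => [])
      tm.m (compCode tm eout p kin) (fun _ => rfl) n _ _ hn
    have r1 : RunsIn (TM2.step (compCode tm eout p kin)) (time.eval (ea a).length) _ _ :=
      ⟨n, hle, e1⟩
    have r2 := runsIn_move tm eout p kin ((eb (f a)).map eout.invFun)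
      (haltList tm ((eb (f a)).map eout.invFun)).stk (fun _ => []) tm.initialState none
      (by simp [haltList])
    have hin : update (fun _ : K => ([] : List A)) kin
        ((((eb (f a)).map eout.invFun).map eout).reverse ++ [])
          = update (fun _ => []) kin (eb (f a)).reverse := by
      simp
    rw [hin] at r2
    obtain ⟨o, r3⟩ := (hp (f a)).runsIn (M := compCode tm eout p kin) CompLab.snd CompLab.done
      (fun _ => rfl) (update (haltList tm ((eb (f a)).map eout.invFun)).stk tm.k₁ [])
      tm.initialState none
    have r4 : RunsIn (TM2.step (compCode tm eout p kin)) 1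
        ⟨some .done, (tm.initialState, o), join (update (haltList tm
          ((eb (f a)).map eout.invFun)).stk tm.k₁ []) (update (fun _ => []) kout (ec (g (f a))))⟩
        (haltList (compMachine tm eout p kin kout) (ec (g (f a)))) := by
      rw [← mk_eq_haltList tm eout p kin kout ((eb (f a)).map eout.invFun)]
      exact RunsIn.single rfl
    have r := ((r1.trans r2).trans r3).trans r4
    rw [liftCfg_initList tm eout p kin kout] at r
    refine r.mono ?_
    have h2 := hlen a
    have h3 := eval_mono T h2
    simp only [List.length_map, Polynomial.eval_add, Polynomial.eval_comp, Polynomial.eval_one]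
    omega
  refine ⟨⟨⟨compMachine tm eout p kin kout, ein, Equiv.refl _⟩, time + (size + 1) + T.comp size + 1,
    fun a => ⟨⟨(key a).choose, ?_⟩, (key a).choose_spec.1⟩⟩⟩
  exact (key a).choose_spec.2.trans (congrArg (fun w => some (haltList _ w)) (List.map_id _).symm)

end StackProgram

/-! ### Derived programs -/

namespace StackProgram

open Function

section Derived

variable {K A : Type} [DecidableEq K]

/-- Each step of a program pushes at most one letter. -/
theorem Exec.length_le {p : Prog K A} {s s' : K → List A} {t : ℕ} (h : Exec p s s' t) (k : K) :
    (s' k).length ≤ (s k).length + t := by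
  induction h with
  | skip s => omega
  | push k' a s =>
    by_cases h : k = k'
    · subst h; simp
    · simp [h]
  | seq _ _ ih₁ ih₂ => omega
  | @case k' p s s' t _ ih =>
    refine ih.trans ?_
    by_cases h : k = k'
    · subst h; simp; omega
    · simp [h]
  | loop_nil _ => omega
  | @loop_cons k' p s s' s'' a l t u hs _ _ ih₁ ih₂ =>
    have : (update s k' l k).length ≤ (s k).length := by
      by_cases h : k = k'
      · subst h; simp [hs]
      · simp [h]
    omega
  | weaken _ _ ih => omega

theorem Exec.congr {p : Prog K A} {s s' r r' : K → List A} {t u : ℕ} (h : Exec p s s' t)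
    (hs : s = r) (hs' : s' = r') (ht : t ≤ u) : Exec p r r' u := by
  subst hs hs'
  exact h.weaken ht

/-- A loop over a stack that holds the word `l`, where `F i` are the stack contents before the
letter number `i` is popped. -/
theorem Exec.loop {k : K} {p : A → Prog K A} (l : List A) (F : ℕ → K → List A) {t : ℕ}
    (hF : ∀ i, F i k = l.drop i)
    (h : ∀ (i : ℕ) (hi : i < l.length),
      Exec (p l[i]) (update (F i) k (l.drop (i + 1))) (F (i + 1)) t) :
    Exec (.loop k p) (F 0) (F l.length) (l.length * (t + 1) + 1) := by
  have key : ∀ j ≤ l.length,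
      Exec (.loop k p) (F (l.length - j)) (F l.length) (j * (t + 1) + 1) := by
    intro j
    induction j with
    | zero =>
      intro _
      exact (Exec.loop_nil (by simp [hF])).weaken (by omega)
    | succ j ih =>
      intro hj
      have hi : l.length - (j + 1) < l.length := by omega
      have e : l.length - (j + 1) + 1 = l.length - j := by omega
      have h₁ := h _ hi
      rw [e] at h₁
      refine (Exec.loop_cons (a := l[l.length - (j + 1)]) (l := l.drop (l.length - j)) ?_ h₁
        (ih (by omega))).weaken ?_
      · rw [hF, List.drop_eq_getElem_cons hi, e]
      · rw [Nat.succ_mul]; omega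
  simpa using key l.length le_rfl

/-- Move the contents of the stack `k` to the stack `k'`, reversing their order. -/
def pour (k k' : K) : Prog K A :=
  .loop k fun a => .push k' a

theorem exec_pour {k k' : K} (hk : k ≠ k') (s : K → List A) :
    Exec (pour k k') s (update (update s k []) k' ((s k).reverse ++ s k'))
      (2 * (s k).length + 1) := by
  refine (Exec.loop (s k)
    (fun i => update (update s k ((s k).drop i)) k' (((s k).take i).reverse ++ s k'))
    (t := 1) ?_ ?_).congr ?_ ?_ ?_
  · intro i; simp [hk]
  · intro i hi
    refine (Exec.push _ _ _).congr rfl ?_ le_rfl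
    rw [update_of_ne hk.symm, update_self, update_comm hk, update_idem, update_comm hk.symm,
      update_idem, List.take_succ_eq_append_getElem hi, List.reverse_append]
    rfl
  · simp
  · simp
  · omega

/-- Empty a stack. -/
def clear (k : K) : Prog K A :=
  .loop k fun _ => .skip

theorem exec_clear (k : K) (s : K → List A) :
    Exec (clear k) s (update s k []) (2 * (s k).length + 1) := by
  refine (Exec.loop (s k) (fun i => update s k ((s k).drop i)) (t := 1) ?_ ?_).congr ?_ ?_ ?_
  · intro i; simp
  · intro i hi
    exact (Exec.skip _).congr (by simp) rfl le_rfl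
  · simp
  · simp
  · omega

/-- Run a program once for each letter on the stack `k`, which is restored with the help of the
stack `tmp`. -/
def rep (k tmp : K) (p : Prog K A) : Prog K A :=
  .seq (.loop k fun a => .seq (.push tmp a) p) (pour tmp k)

/-- Here `G i` are the stack contents after `i` rounds. Since `k` and `tmp` change in the course of
the loop, a round has to go from `G i` to `G (i + 1)` whatever is on these two stacks. -/
theorem exec_rep {k tmp : K} (hk : k ≠ tmp) {p : Prog K A} (l : List A) (G : ℕ → K → List A)
    {t : ℕ} (hGk : ∀ i, G i k = l) (hGt : ∀ i, G i tmp = [])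
    (h : ∀ i u w, Exec p (update (update (G i) k u) tmp w)
      (update (update (G (i + 1)) k u) tmp w) t) :
    Exec (rep k tmp p) (G 0) (G l.length) (l.length * (t + 4) + 2) := by
  have h₁ := Exec.loop (k := k) (p := fun a => .seq (.push tmp a) p) l
    (fun i => update (update (G i) k (l.drop i)) tmp (l.take i).reverse) (t := 1 + t)
    (fun i => by simp [hk]) (fun i hi => by
      refine (Exec.push _ _ _).seq ((h i (l.drop (i + 1)) (l.take (i + 1)).reverse).congr ?_ rfl
        le_rfl)
      rw [List.take_succ_eq_append_getElem hi]
      funext z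
      by_cases hz : z = tmp
      · subst hz; simp [hk.symm]
      · by_cases hz' : z = k
        · subst hz'; simp [hk]
        · simp [hz, hz'])
  refine (h₁.seq (exec_pour hk.symm _)).congr ?_ ?_ ?_
  · rw [List.drop_zero, List.take_zero, List.reverse_nil, ← hGk 0, ← hGt 0, update_eq_self,
      update_eq_self]
  · rw [update_self, update_of_ne hk, update_self, update_idem, update_comm hk.symm, update_idem]
    simp only [List.drop_length, List.take_length, List.reverse_reverse, List.append_nil]
    funext z
    by_cases hz : z = tmp
    · subst hz; simp [hGt]
    · by_cases hz' : z = k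
      · subst hz'; simp [hk, hGk]
      · simp [hz, hz']
  · rw [update_self, List.length_reverse, List.length_take]
    simp only [Nat.mul_add]
    omega

end Derived

end StackProgram

/-! ### Loop programs on a coloured graph -/

namespace DistanceGame

open Function StackProgram

/-- The stacks of the reduction program: the input, the output in reverse order, the output, the
list of cells, the adjacency matrix, its part already read, a few stacks for intermediate results,
and for each loop variable the cells before and after its current value. -/
inductive Stack
  | inp | out | res | cell | mat | matDone | tmp | tmp' | flag | over
  | left (x : Fin 4)
  | right (x : Fin 4)
  deriving DecidableEq, Fintype

instance : Inhabited Letter := ⟨.entry false⟩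

/-- The programs of the reduction. -/
abbrev GProg := Prog Stack Letter

section States

variable {n : ℕ}

/-- The stack contents at a time when the loop variables have the values `env` (`none` outside the
loop of the variable) and `acc` has been written so far, in reverse order. -/
def store (c : Fin n → Letter) (M : List Letter) (env : Fin 4 → Option (Fin n))
    (acc : List Letter) : Stack → List Letter
  | .out => acc
  | .cell => List.ofFn c
  | .mat => M
  | .left x => (env x).elim [] fun i => ((List.ofFn c).take i).reverse
  | .right x => (env x).elim (List.ofFn c) fun i => (List.ofFn c).drop (i + 1)
  | _ => []

/-- `Computes c M env P w τ`: when the loop variables have the values `env`, the program `P` writes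
the word `w`, in time `τ(n)`. -/
def Computes (c : Fin n → Letter) (M : List Letter) (env : Fin 4 → Option (Fin n)) (P : GProg)
    (w : List Letter) (τ : Polynomial ℕ) : Prop :=
  ∀ acc, Exec P (store c M env acc) (store c M env (w.reverse ++ acc)) (τ.eval n)

variable {c : Fin n → Letter} {M : List Letter} {env : Fin 4 → Option (Fin n)}

theorem Computes.mono {P : GProg} {w : List Letter} {τ τ' : Polynomial ℕ}
    (h : Computes c M env P w τ) (hτ : τ.eval n ≤ τ'.eval n) : Computes c M env P w τ' :=
  fun acc => (h acc).weaken hτ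

theorem computes_push (a : Letter) : Computes c M env (.push .out a) [a] 1 := by
  intro acc
  refine (Exec.push _ _ _).congr rfl ?_ (by simp)
  funext z
  cases z <;> simp [store]

theorem computes_skip : Computes c M env .skip [] 1 :=
  fun acc => (Exec.skip _).congr rfl (by simp) (by simp)

theorem Computes.seq {P Q : GProg} {w w' : List Letter} {τ τ' : Polynomial ℕ}
    (h : Computes c M env P w τ) (h' : Computes c M env Q w' τ') :
    Computes c M env (.seq P Q) (w ++ w') (τ + τ') := by
  intro acc
  exact ((h acc).seq (h' _)).congr rfl (by simp) (by simp)

/-- Run programs one after the other. -/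
def seqList : List GProg → GProg
  | [] => .skip
  | P :: l => .seq P (seqList l)

theorem computes_seqList {ι : Type} (l : List ι) {P : ι → GProg} {w : ι → List Letter}
    {τ : Polynomial ℕ} (h : ∀ i ∈ l, Computes c M env (P i) (w i) τ) :
    Computes c M env (seqList (l.map P)) (l.flatMap w) (l.length * τ + 1) := by
  induction l with
  | nil => exact computes_skip.mono (by simp)
  | cons i l ih =>
    refine ((h i (by simp)).seq (ih fun j hj => h j (by simp [hj]))).mono ?_
    simp only [List.length_cons, Polynomial.eval_add, Polynomial.eval_mul,
      Polynomial.eval_natCast, Polynomial.eval_one, Nat.cast_add, Nat.cast_one, add_mul, one_mul]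
    omega

/-- Let the variable `x` run over all vertices; the cell of the vertex is passed to the body. -/
def forVertex (x : Fin 4) (P : Letter → GProg) : GProg :=
  .seq (.loop (.right x) fun a => .seq (P a) (.push (.left x) a)) (pour (.left x) (.right x))

theorem computes_forVertex {x : Fin 4} (hx : env x = none) {P : Letter → GProg}
    {w : Fin n → List Letter} {τ : Polynomial ℕ}
    (h : ∀ i, Computes c M (update env x (some i)) (P (c i)) (w i) τ) :
    Computes c M env (forVertex x P) ((List.finRange n).flatMap w)
      (Polynomial.X * (τ + 4) + 2) := by
  intro acc
  -- `out i` and `F i` are the output and the stack contents before round `i`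
  let out : ℕ → List Letter := fun i => (((List.finRange n).take i).flatMap w).reverse ++ acc
  let F : ℕ → Stack → List Letter := fun i =>
    update (update (store c M env (out i)) (.right x) ((List.ofFn c).drop i)) (.left x)
      ((List.ofFn c).take i).reverse
  have h₁ := Exec.loop (k := .right x) (p := fun a => .seq (P a) (.push (.left x) a))
    (List.ofFn c) F (t := τ.eval n + 1) (fun i => by simp [F]) (fun i hi => by
      have hi' : i < n := by simpa using hi
      have hout : out (i + 1) = (w ⟨i, hi'⟩).reverse ++ out i := by
        simp only [out]
        rw [List.take_succ_eq_append_getElem (by simpa using hi')]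
        simp
      rw [List.getElem_ofFn]
      refine ((h ⟨i, hi'⟩ (out i)).congr ?_ rfl le_rfl).seq ((Exec.push _ _ _).congr rfl ?_ le_rfl)
      · funext z
        rcases z with _ | _ | _ | _ | _ | _ | _ | _ | _ | _ | y | y <;> simp [F, store]
        all_goals
          by_cases hy : y = x
          · subst hy; simp
          · simp [hy, store]
      · funext z
        rcases z with _ | _ | _ | _ | _ | _ | _ | _ | _ | _ | y | y <;> simp [F, store, hout]
        all_goals
          by_cases hy : y = x
          · subst hy; simp [List.take_succ_eq_append_getElem hi]
          · simp [hy, store])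
  refine (h₁.seq (exec_pour (by simp) _)).congr ?_ ?_ ?_
  · funext z
    rcases z with _ | _ | _ | _ | _ | _ | _ | _ | _ | _ | y | y <;> simp [F, store, out]
    all_goals
      by_cases hy : y = x
      · subst hy; simp [hx]
      · simp [hy, store]
  · have hlen : out n = ((List.finRange n).flatMap w).reverse ++ acc := by
      simp only [out]
      rw [List.take_of_length_le (by simp)]
    funext z
    rcases z with _ | _ | _ | _ | _ | _ | _ | _ | _ | _ | y | y <;> simp [F, store]
    · simpa using hlen
    all_goals
      by_cases hy : y = x
      · subst hy; simp [hx]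
      · simp [hy, store]
  · simp [F]
    ring_nf
    omega

/-! ### Comparing variables and looking up edges -/

/-- Compare the values of two variables, and continue accordingly. The number of letters before
the first value is counted up on the stack `flag` and then counted down by the letters before the
second; the excess of the second goes to the stack `over`. -/
def ifEq (x y : Fin 4) (P Q : GProg) : GProg :=
  .seq (rep (.left x) .tmp (.push .flag default)) <|
  .seq (rep (.left y) .tmp
    (.case .flag fun o => o.elim (.push .over default) fun _ => .skip)) <|
  .case .flag fun o => .case .over fun o' => .seq (clear .flag) <| .seq (clear .over) <|
    if o = none ∧ o' = none then P else Q

theorem computes_ifEq {x y : Fin 4} {i j : Fin n} (hx : env x = some i) (hy : env y = some j)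
    {P Q : GProg} {w : List Letter} {τ : Polynomial ℕ}
    (hP : i = j → Computes c M env P w τ) (hQ : i ≠ j → Computes c M env Q w τ) :
    Computes c M env (ifEq x y P Q) w (τ + 15 * Polynomial.X + 8) := by
  intro acc
  set s := store c M env acc with hs
  have hlx : (s (.left x)).length = i := by simp [hs, store, hx, i.2.le]
  have hly : (s (.left y)).length = j := by simp [hs, store, hy, j.2.le]
  let r : ℕ → List Letter := fun m => List.replicate m default
  have h₁ := exec_rep (k := .left x) (tmp := .tmp) (by simp) (p := .push .flag default)
    (s (.left x)) (fun m => update s .flag (r m)) (t := 1) (by simp) (by simp [hs, store])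
    (fun m u w => (Exec.push _ _ _).congr rfl (by
      funext z
      rcases z with _ | _ | _ | _ | _ | _ | _ | _ | _ | _ | z | z <;>
        simp [r, List.replicate_succ]
      by_cases hz : z = x
      · subst hz; simp
      · simp [hz]) le_rfl)
  have h₂ := exec_rep (k := .left y) (tmp := .tmp) (by simp)
    (p := .case .flag fun o => o.elim (.push .over default) fun _ => .skip)
    (s (.left y)) (fun m => update (update s .flag (r (i - m))) .over (r (m - i))) (t := 2)
    (by simp) (by simp [hs, store])
    (fun m u w => by
      refine Exec.case ?_
      -- as long as `m < i` there is a letter to remove from `flag`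
      by_cases hm : m < i
      · obtain ⟨a, ha⟩ : ∃ a, (i : ℕ) - m = a + 1 := ⟨i - m - 1, by omega⟩
        have ha' : (i : ℕ) - (m + 1) = a := by omega
        have h0 : m - (i : ℕ) = 0 := by omega
        have h0' : m + 1 - (i : ℕ) = 0 := by omega
        have : update (update (update (update s .flag (r (i - m))) .over (r (m - i)))
          (.left y) u) .tmp w .flag = default :: r a := by
          simp [r, ha, List.replicate_succ]
        rw [this]
        refine (Exec.skip _).congr ?_ rfl le_rfl
        funext z
        rcases z with _ | _ | _ | _ | _ | _ | _ | _ | _ | _ | z | z <;> simp [h0, h0', ha']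
        by_cases hz : z = y
        · subst hz; simp
        · simp [hz]
      · have h0 : (i : ℕ) - m = 0 := by omega
        have h0' : (i : ℕ) - (m + 1) = 0 := by omega
        have h1 : m + 1 - (i : ℕ) = m - i + 1 := by omega
        have : update (update (update (update s .flag (r (i - m))) .over (r (m - i)))
          (.left y) u) .tmp w .flag = [] := by
          simp [r, h0]
        rw [this]
        refine (Exec.push _ _ _).congr rfl ?_ le_rfl
        funext z
        rcases z with _ | _ | _ | _ | _ | _ | _ | _ | _ | _ | z | z <;>
          simp [h0', h1, r, List.replicate_succ]
        by_cases hz : z = y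
        · subst hz; simp
        · simp [hz])
  have e : update s .flag (r i) = update (update s .flag (r (i - 0))) .over (r (0 - i)) := by
    funext z
    rcases z with _ | _ | _ | _ | _ | _ | _ | _ | _ | _ | z | z <;> simp [r, hs, store]
  have e₀ : update s .flag (r 0) = s := by
    funext z
    rcases z with _ | _ | _ | _ | _ | _ | _ | _ | _ | _ | z | z <;> simp [r, hs, store]
  rw [hlx, e₀] at h₁
  rw [hly] at h₂
  -- one of the truncated differences is positive unless `i = j`
  set s₂ := update (update s .flag (r (i - j))) .over (r (j - i)) with hs₂
  have hf : s₂ .flag = r (i - j) := by simp [hs₂]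
  have ho : s₂ .over = r (j - i) := by simp [hs₂]
  have hres : update (update (update (update s₂ .flag (s₂ .flag).tail) .over
      ((update s₂ .flag (s₂ .flag).tail) .over).tail) .flag []) .over [] = s := by
    funext z
    rcases z with _ | _ | _ | _ | _ | _ | _ | _ | _ | _ | z | z <;> simp [hs₂, hs, store]
  have h₃ : Exec (if (s₂ .flag).head? = none ∧ ((update s₂ .flag (s₂ .flag).tail) .over).head? = none
      then P else Q) s (store c M env (w.reverse ++ acc)) (τ.eval n) := by
    by_cases hij : i = j
    · rw [if_pos (by subst hij; simp [hf, ho, r])]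
      exact hP hij acc
    · rw [if_neg]
      · exact hQ hij acc
      · have : (i : ℕ) ≠ j := fun h => hij (Fin.ext h)
        simp [hf, ho, r]
        omega
  refine (h₁.seq ((h₂.congr e.symm rfl le_rfl).seq (Exec.case (Exec.case ((exec_clear _ _).seq
    ((exec_clear _ _).seq (h₃.congr ?_ rfl le_rfl))))))).congr rfl rfl ?_
  · exact hres.symm
  · simp [hf, ho, r]
    have := i.2
    have := j.2
    omega

/-- Remember the next entry of the matrix as read. -/
def nextEntry : GProg :=
  .case .mat fun o => o.elim .skip (.push .matDone)

/-- The stack contents when the first `m` entries of the matrix have been read. -/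
def advance (M : List Letter) (s : Stack → List Letter) (m : ℕ) : Stack → List Letter :=
  update (update s .mat (M.drop m)) .matDone (M.take m).reverse

theorem advance_update (s : Stack → List Letter) (m : ℕ) {k : Stack} (u : List Letter)
    (h₁ : k ≠ .mat) (h₂ : k ≠ .matDone) :
    update (advance M s m) k u = advance M (update s k u) m := by
  rw [advance, advance, update_comm h₂.symm, update_comm h₁.symm]

theorem exec_nextEntry (s : Stack → List Letter) (m : ℕ) :
    Exec nextEntry (advance M s m) (advance M s (m + 1)) 2 := by
  refine Exec.case ?_
  by_cases hm : m < M.length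
  · have : advance M s m .mat = M[m] :: M.drop (m + 1) := by
      rw [advance, update_of_ne (by simp), update_self, List.drop_eq_getElem_cons hm]
    rw [this]
    refine (Exec.push _ _ _).congr rfl ?_ le_rfl
    funext z
    cases z <;> simp [advance]
    rw [List.take_succ_eq_append_getElem hm, List.reverse_append]
    rfl
  · have : advance M s m .mat = [] := by
      simp [advance]; omega
    rw [this]
    refine (Exec.skip _).congr rfl ?_ le_rfl
    funext z
    cases z <;> simp [advance]
    · omega
    · omega

/-- Skip as many entries of the matrix as there are vertices. -/
def nextRow : GProg :=
  rep .cell .tmp' nextEntry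

theorem exec_nextRow (s : Stack → List Letter) (h : s .tmp' = []) (m : ℕ) :
    Exec nextRow (advance M s m) (advance M s (m + (s .cell).length))
      (6 * (s .cell).length + 2) := by
  refine (exec_rep (k := .cell) (tmp := .tmp') (by simp) (s .cell)
    (fun i => advance M s (m + i)) (t := 2) (by simp [advance]) (by simpa [advance] using h)
    (fun i u w => ?_)).congr rfl rfl (by omega)
  rw [advance_update _ _ _ (by simp) (by simp), advance_update _ _ _ (by simp) (by simp),
    advance_update _ _ _ (by simp) (by simp), advance_update _ _ _ (by simp) (by simp)]
  exact exec_nextEntry _ _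

theorem getElem?_flatten_ofFn {α : Type} {m n : ℕ} (f : Fin m → Fin n → α) (i : Fin m)
    (j : Fin n) :
    (List.ofFn fun i => List.ofFn fun j => f i j).flatten[(i : ℕ) * n + j]? = some (f i j) := by
  induction m with
  | zero => exact i.elim0
  | succ m ih =>
    rw [List.ofFn_succ, List.flatten_cons]
    induction i using Fin.cases with
    | zero =>
      rw [List.getElem?_append_left (by simp)]
      simp
    | succ i =>
      rw [List.getElem?_append_right (by simp [Nat.succ_mul]; omega)]
      have e : ((i.succ : Fin (m + 1)) : ℕ) * n + j - (List.ofFn fun j => f 0 j).length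
          = (i : ℕ) * n + j := by
        simp [Nat.succ_mul]; omega
      rw [e]
      exact ih (fun i => f i.succ) i

/-- Continue according to the entry of the adjacency matrix in the row and the column given by two
variables: the matrix is read up to this entry, and restored afterwards. -/
def ifAdj (x y : Fin 4) (P Q : GProg) : GProg :=
  .seq (rep (.left x) .tmp nextRow) <|
  .seq (rep (.left y) .tmp nextEntry) <|
  .case .mat fun o => .seq (o.elim .skip (.push .mat)) <|
    .seq (pour .matDone .mat) (if o = some (.entry true) then P else Q)

theorem computes_ifAdj {x y : Fin 4} {i j : Fin n} (hx : env x = some i) (hy : env y = some j)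
    {adj : Fin n → Fin n → Bool}
    (hM : M = (List.ofFn fun i => List.ofFn fun j => Letter.entry (adj i j)).flatten)
    {P Q : GProg} {w : List Letter} {τ : Polynomial ℕ}
    (hP : adj i j = true → Computes c M env P w τ)
    (hQ : adj i j = false → Computes c M env Q w τ) :
    Computes c M env (ifAdj x y P Q) w
      (τ + 8 * Polynomial.X ^ 2 + 14 * Polynomial.X + 8) := by
  intro acc
  set s := store c M env acc with hs
  have hlx : (s (.left x)).length = i := by simp [hs, store, hx, i.2.le]
  have hly : (s (.left y)).length = j := by simp [hs, store, hy, j.2.le]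
  have hlc : (s .cell).length = n := by simp [hs, store]
  have e₀ : advance M s 0 = s := by
    funext z
    cases z <;> simp [advance, hs, store]
  have h₁ := exec_rep (k := .left x) (tmp := .tmp) (by simp) (p := nextRow)
    (s (.left x)) (fun m => advance M s (m * n)) (t := 6 * n + 2) (by simp [advance])
    (by simp [advance, hs, store]) (fun m u w => by
      rw [advance_update _ _ _ (by simp) (by simp), advance_update _ _ _ (by simp) (by simp),
        advance_update _ _ _ (by simp) (by simp), advance_update _ _ _ (by simp) (by simp)]
      refine (exec_nextRow _ (by simp [hs, store]) _).congr rfl ?_ ?_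
      · simp [hlc, Nat.succ_mul]
      · simp [hlc])
  have h₂ := exec_rep (k := .left y) (tmp := .tmp) (by simp) (p := nextEntry)
    (s (.left y)) (fun m => advance M s (i * n + m)) (t := 2) (by simp [advance])
    (by simp [advance, hs, store]) (fun m u w => by
      rw [advance_update _ _ _ (by simp) (by simp), advance_update _ _ _ (by simp) (by simp),
        advance_update _ _ _ (by simp) (by simp), advance_update _ _ _ (by simp) (by simp)]
      exact exec_nextEntry _ _)
  rw [hlx, Nat.zero_mul, e₀] at h₁
  rw [hly, Nat.add_zero] at h₂
  have hlen : M.length = n * n := by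
    rw [hM]; simp [List.sum_ofFn]
  have hidx : (i : ℕ) * n + j < M.length := by
    rw [hlen]
    calc (i : ℕ) * n + j < i * n + n := by have := j.2; omega
      _ = (i + 1) * n := by ring
      _ ≤ n * n := Nat.mul_le_mul_right n i.2
  have hget : M[(i : ℕ) * n + j] = .entry (adj i j) := by
    rw [List.getElem_eq_iff, hM]
    exact getElem?_flatten_ofFn _ i j
  -- the stack contents when the entry in row `i` and column `j` comes next
  set s₂ := advance M s (i * n + j) with hs₂
  have hmat : s₂ .mat = .entry (adj i j) :: M.drop (i * n + j + 1) := by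
    simp [hs₂, advance, List.drop_eq_getElem_cons hidx, hget]
  have hdone : s₂ .matDone = (M.take (i * n + j)).reverse := by
    simp [hs₂, advance]
  have h₃ : Exec (if (some (Letter.entry (adj i j))) = some (.entry true) then P else Q) s
      (store c M env (w.reverse ++ acc)) (τ.eval n) := by
    cases h : adj i j
    · rw [if_neg (by simp)]
      exact hQ h acc
    · rw [if_pos rfl]
      exact hP h acc
  have h₄ : Exec (Prog.seq ((some (Letter.entry (adj i j))).elim .skip (.push .mat)) <|
      .seq (pour .matDone .mat)
        (if some (Letter.entry (adj i j)) = some (.entry true) then P else Q))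
      (update s₂ .mat (M.drop (i * n + j + 1))) (store c M env (w.reverse ++ acc))
      (1 + (2 * (i * n + j) + 1 + τ.eval n)) := by
    refine (Exec.push _ _ _).seq (((exec_pour (by simp) _).congr rfl ?_ ?_).seq h₃)
    · funext z
      have := List.take_append_drop (i * n + j) M
      rw [List.drop_eq_getElem_cons hidx, hget] at this
      cases z <;> simp [hs₂, advance, hs, store]
      exact this
    · simp [hs₂, advance]
  refine (h₁.seq (h₂.seq (Exec.case (s' := store c M env (w.reverse ++ acc))
    (t := 1 + (2 * (i * n + j) + 1 + τ.eval n)) ?_))).congr rfl rfl ?_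
  · rw [hmat]
    exact h₄
  · simp only [Polynomial.eval_add, Polynomial.eval_mul, Polynomial.eval_pow, Polynomial.eval_X,
      Polynomial.eval_ofNat]
    have := i.2
    have := j.2
    have : (i : ℕ) * n ≤ n * n := Nat.mul_le_mul_right n i.2.le
    nlinarith

/-! ### Reading the instance and writing the result -/

/-- Sort the letters of the input; the stacks of all loop variables receive a copy of the cells. -/
def readInput : GProg :=
  .loop .inp fun a =>
    match a with
    | .turn _ => .push .out a
    | .cell _ => .seq (.push .cell a) <| .seq (.push (.right 0) a) <| .seq (.push (.right 1) a) <|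
        .seq (.push (.right 2) a) (.push (.right 3) a)
    | .entry _ => .push .mat a

/-- The stack contents when the word `l` is still to be read and the word `w`, which comes after
`l`'s reversal in the input, has been read. -/
def reading (l w : List Letter) : Stack → List Letter
  | .inp => l
  | .out => w.filter fun a => match a with | .turn _ => true | _ => false
  | .cell | .right _ => w.filter fun a => match a with | .cell _ => true | _ => false
  | .mat => w.filter fun a => match a with | .entry _ => true | _ => false
  | _ => []

theorem exec_readInput (l w : List Letter) :
    Exec readInput (reading l w) (reading [] (l.reverse ++ w)) (6 * l.length + 1) := by
  induction l generalizing w with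
  | nil => exact Exec.loop_nil rfl
  | cons a l ih =>
    refine (Exec.loop_cons (a := a) (l := l) (s' := reading l (a :: w)) (t := 5) rfl ?_
      (ih (a :: w))).congr rfl (by simp) (by simp; omega)
    rcases a with p | p | p
    · refine (Exec.push _ _ _).congr rfl ?_ (by omega)
      funext z
      cases z <;> simp [reading]
    · refine ((Exec.push _ _ _).seq ((Exec.push _ _ _).seq ((Exec.push _ _ _).seq
        ((Exec.push _ _ _).seq (Exec.push _ _ _))))).congr rfl ?_ (by omega)
      funext z
      rcases z with _ | _ | _ | _ | _ | _ | _ | _ | _ | _ | z | z <;> simp [reading]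
      fin_cases z <;> simp
    · refine (Exec.push _ _ _).congr rfl ?_ (by omega)
      funext z
      cases z <;> simp [reading]

/-- Read the input, run a program, and write the result onto the output stack. -/
def wrap (P : GProg) : GProg :=
  .seq readInput <| .seq P <| .seq (pour .out .res) <| .seq (clear .cell) <| .seq (clear .mat) <|
    .seq (clear (.right 0)) <| .seq (clear (.right 1)) <| .seq (clear (.right 2))
      (clear (.right 3))

/-- The time bound uses that the word written by `P` is not longer than the running time of `P`. -/
theorem exec_wrap {n : ℕ} (c : Fin n → Option Player) (adj : Fin n → Fin n → Bool) (p : Player)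
    {P : GProg} {w : List Letter} {τ : Polynomial ℕ}
    (h : Computes (fun i => .cell (c i))
      (List.ofFn fun i => List.ofFn fun j => Letter.entry (adj i j)).flatten (fun _ => none) P w τ)
    {word : List Letter}
    (hword : word = .turn p :: (List.ofFn (fun i => Letter.cell (c i)) ++
      (List.ofFn fun i => List.ofFn fun j => Letter.entry (adj i j)).flatten)) :
    Exec (wrap P) (update (fun _ => []) .inp word.reverse) (update (fun _ => []) .res (.turn p :: w))
      ((3 * τ + 18 * Polynomial.X + 20).eval word.length) := by
  set M := (List.ofFn fun i => List.ofFn fun j => Letter.entry (adj i j)).flatten with hM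
  have e₁ : update (fun _ => []) .inp word.reverse = reading word.reverse [] := by
    funext z
    cases z <;> simp [reading]
  have e₂ : reading [] (word.reverse.reverse ++ []) = store (fun i => .cell (c i)) M
      (fun _ => none) [.turn p] := by
    have hc : ∀ a ∈ List.ofFn (fun i => Letter.cell (c i)), ∃ i, a = .cell (c i) := by
      intro a ha
      obtain ⟨i, rfl⟩ := List.mem_ofFn.1 ha
      exact ⟨i, rfl⟩
    have hm : ∀ a ∈ M, ∃ i j, a = .entry (adj i j) := by
      intro a ha
      rw [hM, List.mem_flatten] at ha
      obtain ⟨l, hl, ha⟩ := ha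
      obtain ⟨i, rfl⟩ := List.mem_ofFn.1 hl
      obtain ⟨j, rfl⟩ := List.mem_ofFn.1 ha
      exact ⟨i, j, rfl⟩
    have f₁ : (List.ofFn (fun i => Letter.cell (c i))).filter
        (fun a => match a with | .turn _ => true | _ => false) = [] :=
      List.filter_eq_nil_iff.2 fun a ha => by obtain ⟨i, rfl⟩ := hc a ha; simp
    have f₂ : (List.ofFn (fun i => Letter.cell (c i))).filter
        (fun a => match a with | .cell _ => true | _ => false)
          = List.ofFn (fun i => Letter.cell (c i)) :=
      List.filter_eq_self.2 fun a ha => by obtain ⟨i, rfl⟩ := hc a ha; simp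
    have f₃ : (List.ofFn (fun i => Letter.cell (c i))).filter
        (fun a => match a with | .entry _ => true | _ => false) = [] :=
      List.filter_eq_nil_iff.2 fun a ha => by obtain ⟨i, rfl⟩ := hc a ha; simp
    have g₁ : M.filter (fun a => match a with | .turn _ => true | _ => false) = [] :=
      List.filter_eq_nil_iff.2 fun a ha => by obtain ⟨i, j, rfl⟩ := hm a ha; simp
    have g₂ : M.filter (fun a => match a with | .cell _ => true | _ => false) = [] :=
      List.filter_eq_nil_iff.2 fun a ha => by obtain ⟨i, j, rfl⟩ := hm a ha; simp
    have g₃ : M.filter (fun a => match a with | .entry _ => true | _ => false) = M :=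
      List.filter_eq_self.2 fun a ha => by obtain ⟨i, j, rfl⟩ := hm a ha; simp
    funext z
    rcases z with _ | _ | _ | _ | _ | _ | _ | _ | _ | _ | z | z <;>
      simp only [reading, store, List.reverse_reverse, List.append_nil, hword,
        List.filter_cons, List.filter_append, f₁, f₂, f₃, g₁, g₂, g₃] <;> simp
  have hlen : word.length = 1 + n + n * n := by
    rw [hword, hM]; simp [List.sum_ofFn]; omega
  have hMlen : M.length = n * n := by
    rw [hM]; simp [List.sum_ofFn]
  have h₁ := exec_readInput word.reverse []
  have h₂ := h [.turn p]
  have hw := h₂.length_le .out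
  simp only [store, List.length_append, List.length_reverse, List.length_singleton] at hw
  have hτ := eval_mono τ (m := n) (n := word.length) (by omega)
  rw [← e₁, e₂] at h₁
  refine (h₁.seq (h₂.seq ((exec_pour (by simp) _).seq ((exec_clear _ _).seq ((exec_clear _ _).seq
    ((exec_clear _ _).seq ((exec_clear _ _).seq ((exec_clear _ _).seq
      (exec_clear _ _))))))))).congr rfl ?_ ?_
  · funext z
    rcases z with _ | _ | _ | _ | _ | _ | _ | _ | _ | _ | z | z <;> simp [store]
    fin_cases z <;> simp
  · simp [store, hMlen]
    omega

end States

end DistanceGame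

/-! ### Distances and legal positions -/

namespace DistanceGame

open Function

section General

variable {V W : Type}

/-- A function that grows by at most one along each edge bounds distances from below. -/
theorem coe_lt_edist {G : SimpleGraph V} (f : V → ℕ) (hf : ∀ x y, G.Adj x y → f y ≤ f x + 1)
    {m : ℕ} {x y : V} (h : f x + m < f y) : (m : ℕ∞) < G.edist x y := by
  by_contra! hle
  obtain ⟨p, hp⟩ := SimpleGraph.exists_walk_of_edist_ne_top (hle.trans_lt (ENat.natCast_lt_top m)).ne
  have key : ∀ {x y : V} (p : G.Walk x y), f y ≤ f x + p.length := by
    intro x y p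
    induction p with
    | nil => simp
    | cons h p ih =>
      have := hf _ _ h
      rw [SimpleGraph.Walk.length_cons]
      omega
  have h₁ := key p
  rw [← hp] at hle
  have h₂ : p.length ≤ m := by exact_mod_cast hle
  omega

theorem legal_singleton_iff {G : SimpleGraph V} {c : V → Option Player} :
    Legal ∅ {1} G c ↔ ∀ u v p, c u = some p → c v = some p → ¬ G.Adj u v := by
  constructor
  · intro h u v p hu hv hadj
    refine (h u v hadj.ne p p hu hv).2 rfl 1 rfl ?_
    simpa using SimpleGraph.edist_eq_one_iff_adj.2 hadj
  · intro h u v _ p q hu hv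
    refine ⟨fun _ d hd => absurd hd (by simp), ?_⟩
    rintro rfl s rfl hs
    exact h u v p hu hv (SimpleGraph.edist_eq_one_iff_adj.1 (by simpa using hs))

theorem legal_Icc_iff {G : SimpleGraph V} {c : V → Option Player} {k : ℕ} :
    Legal ∅ (Set.Icc 1 k) G c ↔
      ∀ u v p, u ≠ v → c u = some p → c v = some p → (k : ℕ∞) < G.edist u v := by
  constructor
  · intro h u v p huv hu hv
    by_contra! hle
    obtain ⟨m, hm⟩ := ENat.ne_top_iff_exists.1 (hle.trans_lt (ENat.natCast_lt_top k)).ne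
    have hpos := SimpleGraph.edist_pos_of_ne (G := G) huv
    rw [← hm] at hle hpos
    refine (h u v huv p p hu hv).2 rfl m ⟨?_, ?_⟩ hm.symm
    · exact_mod_cast hpos
    · exact_mod_cast hle
  · intro h u v huv p q hu hv
    refine ⟨fun _ d hd => absurd hd (by simp), ?_⟩
    rintro rfl s hs e
    have := h u v p huv hu hv
    rw [e] at this
    have : k < s := by exact_mod_cast this
    exact absurd hs.2 (by omega)

/-- Two games are won by the same player if positions of one can be translated to positions of
the other in such a way that the moves from a position correspond to the moves from its
translation. -/
theorem moverWins_iff {D S D' S' : Set ℕ} {G : SimpleGraph V} {H : SimpleGraph W}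
    (Φ : (V → Option Player) → W → Option Player)
    (hmove : ∀ p c d, IsMove D S G p c d → IsMove D' S' H p (Φ c) (Φ d))
    (hback : ∀ p c e, IsMove D' S' H p (Φ c) e → ∃ d, IsMove D S G p c d ∧ e = Φ d)
    (p : Player) (c : V → Option Player) :
    MoverWins D S G p c ↔ MoverWins D' S' H p (Φ c) := by
  constructor
  · intro h
    induction h with
    | intro c c' move _ ih =>
      refine .intro _ _ (hmove _ _ _ move) fun e he => ?_
      obtain ⟨d, hd, rfl⟩ := hback _ _ _ he
      exact ih d hd
  · intro h
    generalize hx : Φ c = x at h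
    induction h generalizing c with
    | intro x x' move _ ih =>
      subst hx
      obtain ⟨d, hd, rfl⟩ := hback _ _ _ move
      exact .intro _ _ hd fun e he => ih _ (hmove _ _ _ he) e rfl

theorem edist_iso {G : SimpleGraph V} {H : SimpleGraph W} (e : G ≃g H) (u v : V) :
    H.edist (e u) (e v) = G.edist u v := by
  have key : ∀ {V W : Type} {G : SimpleGraph V} {H : SimpleGraph W} (f : G →g H) (u v : V),
      H.edist (f u) (f v) ≤ G.edist u v := by
    intro V W G H f u v
    by_cases h : G.edist u v = ⊤
    · rw [h]; exact le_top
    · obtain ⟨p, hp⟩ := SimpleGraph.exists_walk_of_edist_ne_top h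
      rw [← hp, ← SimpleGraph.Walk.length_map f p]
      exact SimpleGraph.edist_le _
  refine le_antisymm (key e.toHom u v) ?_
  simpa using key e.symm.toHom (e u) (e v)

theorem legal_iso {D S : Set ℕ} {G : SimpleGraph V} {H : SimpleGraph W} (e : G ≃g H)
    (c : W → Option Player) : Legal D S G (c ∘ e) ↔ Legal D S H c := by
  unfold Legal
  rw [← e.toEquiv.forall_congr_right]
  refine forall_congr' fun u => ?_
  rw [← e.toEquiv.forall_congr_right]
  refine forall_congr' fun v => ?_
  have : H.edist (e.toEquiv u) (e.toEquiv v) = G.edist u v := edist_iso e u v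
  rw [this]
  simp

theorem moverWins_iso {D S : Set ℕ} {G : SimpleGraph V} {H : SimpleGraph W} (e : G ≃g H)
    (p : Player) (c : W → Option Player) :
    MoverWins D S H p c ↔ MoverWins D S G p (c ∘ e) := by
  classical
  have hupd : ∀ (c : W → Option Player) (v : V) (p : Player),
      update c (e v) (some p) ∘ e = update (c ∘ e) v (some p) :=
    fun c v p => update_comp_eq_of_injective c e.injective v (some p)
  refine moverWins_iff (fun c => c ∘ e) ?_ ?_ p c
  · rintro p c d ⟨w, hw, rfl, hl⟩
    obtain ⟨v, rfl⟩ := e.surjective w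
    refine ⟨v, hw, ?_, (legal_iso e _).2 hl⟩
    convert hupd c v p
  · rintro p c d ⟨v, hv, rfl, hl⟩
    refine ⟨update c (e v) (some p), ⟨e v, hv, by congr!, ?_⟩, ?_⟩
    · refine (legal_iso e _).1 ?_
      rw [hupd]
      convert hl
    · rw [hupd]

end General

/-! ### The board of the reduction -/

/-- The vertices of the new board: for each vertex `u` of the old board a tail of vertices
`pt u i`, of which the outermost, with `i = b`, stands for `u`; for each ordered pair a vertex
`mid u v`; and a hub of `q + 2` vertices, the first two of which carry pieces. -/
inductive Vtx (n b q : ℕ)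
  | pt (u : Fin n) (i : Fin (b + 1))
  | mid (u v : Fin n)
  | hub (j : Fin (q + 2))

section Board

variable {n b q : ℕ}

/-- The level of a vertex: its distance from the two vertices `hub 0` and `hub 1`, which have
level `0` (the subtraction is truncated). -/
def Vtx.level : Vtx n b q → ℕ
  | .pt _ i => q + 2 + i
  | .mid _ _ => q + 1
  | .hub j => j - 1

/-- The relation that vertices on consecutive levels have to satisfy to be adjacent. The vertex
`mid u v` is linked to the tail of `u`, and, if `u` and `v` are adjacent, to the tail of `v`. -/
def Vtx.Linked (G : SimpleGraph (Fin n)) : Vtx n b q → Vtx n b q → Prop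
  | .pt u _, .pt v _ => u = v
  | .pt w _, .mid u v => w = u ∨ (w = v ∧ G.Adj u v)
  | .mid u v, .pt w _ => w = u ∨ (w = v ∧ G.Adj u v)
  | _, _ => True

/-- The new board. -/
def board (G : SimpleGraph (Fin n)) (b q : ℕ) : SimpleGraph (Vtx n b q) where
  Adj x y := x.Linked G y ∧ (x.level = y.level + 1 ∨ y.level = x.level + 1)
  symm := ⟨by
    rintro (⟨u, i⟩ | ⟨u, v⟩ | j) (⟨u', i'⟩ | ⟨u', v'⟩ | j') ⟨h, h'⟩ <;>
      exact ⟨by first | exact h | exact Eq.symm h, h'.symm⟩⟩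
  loopless := ⟨fun x hx => by have := hx.2; omega⟩

/-- The position on the new board: the pieces of the old board, and one piece of each player on the
hub. -/
def place (c : Fin n → Option Player) : Vtx n b q → Option Player
  | .pt u i => if i = Fin.last b then c u else none
  | .mid _ _ => none
  | .hub j => if (j : ℕ) = 0 then some .left else if (j : ℕ) = 1 then some .right else none

/-- The vertex of the hub with the piece of a player. -/
def base : Player → Vtx n b q
  | .left => .hub ⟨0, by omega⟩
  | .right => .hub ⟨1, by omega⟩

theorem place_base (c : Fin n → Option Player) (p : Player) :
    place c (base p : Vtx n b q) = some p := by
  cases p <;> simp [base, place]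

theorem eq_base_of_level {x : Vtx n b q} (h : x.level = 0) : ∃ p, x = base p := by
  rcases x with ⟨u, i⟩ | ⟨u, v⟩ | ⟨j, hj⟩
  · simp [Vtx.level] at h
  · simp [Vtx.level] at h
  · have : j = 0 ∨ j = 1 := by simp [Vtx.level] at h; omega
    rcases this with rfl | rfl
    · exact ⟨.left, rfl⟩
    · exact ⟨.right, rfl⟩

theorem place_update [DecidableEq (Fin n)] [DecidableEq (Vtx n b q)] (c : Fin n → Option Player) (v : Fin n)
    (o : Option Player) :
    (place (update c v o) : Vtx n b q → Option Player)
      = update (place c) (.pt v (Fin.last b)) o := by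
  funext x
  rcases x with ⟨u, i⟩ | ⟨u, w⟩ | j
  · by_cases hu : u = v
    · subst hu
      by_cases hi : i = Fin.last b
      · subst hi; simp [place]
      · simp [place, hi]
    · simp [place, hu]
  · simp [place]
  · simp [place]

variable {G : SimpleGraph (Fin n)}

/-- A vertex on a level above the pieces has a neighbour one level below. -/
theorem exists_adj_below (x : Vtx n b q) {l : ℕ} (hx : x.level = l + 2) :
    ∃ y, (board G b q).Adj x y ∧ y.level = l + 1 := by
  rcases x with ⟨u, i, hi⟩ | ⟨u, v⟩ | ⟨j, hj⟩
  · simp only [Vtx.level] at hx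
    rcases i with _ | i
    · exact ⟨.mid u u, ⟨Or.inl rfl, Or.inl (by simp [Vtx.level])⟩, by simp [Vtx.level]; omega⟩
    · exact ⟨.pt u ⟨i, by omega⟩, ⟨rfl, Or.inl (by simp [Vtx.level]; omega)⟩,
        by simp [Vtx.level]; omega⟩
  · simp only [Vtx.level] at hx
    exact ⟨.hub (Fin.last _), ⟨trivial, Or.inl (by simp [Vtx.level])⟩, by simp [Vtx.level]; omega⟩
  · simp only [Vtx.level] at hx
    exact ⟨.hub ⟨j - 1, by omega⟩, ⟨trivial, Or.inl (by simp [Vtx.level]; omega)⟩,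
      by simp [Vtx.level]; omega⟩

theorem edist_base_le (hq : 1 ≤ q) (p : Player) (l : ℕ) (x : Vtx n b q) (hx : x.level = l + 1) :
    (board G b q).edist x (base p) ≤ (l + 1 : ℕ) := by
  induction l generalizing x with
  | zero =>
    have : (board G b q).Adj x (base p) := by
      refine ⟨?_, Or.inl ?_⟩
      · rcases x with ⟨u, i⟩ | ⟨u, v⟩ | ⟨j, hj⟩
        · simp [Vtx.level] at hx; omega
        · simp [Vtx.level] at hx; omega
        · cases p <;> trivial
      · rw [hx]; cases p <;> rfl
    rw [SimpleGraph.edist_eq_one_iff_adj.2 this]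
    simp
  | succ l ih =>
    obtain ⟨y, hy, hyl⟩ := exists_adj_below (G := G) x hx
    refine (SimpleGraph.edist_triangle (v := y)).trans ?_
    rw [SimpleGraph.edist_eq_one_iff_adj.2 hy]
    refine (add_le_add_right (ih y hyl) 1).trans ?_
    push_cast
    exact (add_comm _ _).le

theorem level_le_of_adj (x y : Vtx n b q) (h : (board G b q).Adj x y) :
    y.level ≤ x.level + 1 := by
  have := h.2
  omega

open Classical in
/-- A function that vanishes at `pt u b` and grows by at most one along each edge, hence a lower
bound for the distance from `pt u b`. -/
noncomputable def Vtx.far (G : SimpleGraph (Fin n)) (u : Fin n) : Vtx n b q → ℕ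
  | .pt v i => if v = u then b - i else if G.Adj u v then b + 2 + i else b + 4 + i
  | .mid v w => if v = u ∨ (w = u ∧ G.Adj v w) then b + 1 else b + 3
  | .hub _ => b + 2

theorem far_le_of_adj (u : Fin n) (x y : Vtx n b q) (h : (board G b q).Adj x y) :
    y.far G u ≤ x.far G u + 1 := by
  obtain ⟨h, hl⟩ := h
  rcases x with ⟨v, i, hi⟩ | ⟨v, w⟩ | ⟨j, hj⟩ <;> rcases y with ⟨v', i', hi'⟩ | ⟨v', w'⟩ | ⟨j', hj'⟩ <;>
    simp only [Vtx.level, Vtx.Linked] at h hl <;> simp only [Vtx.far]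
  · subst h
    split_ifs <;> omega
  · obtain rfl : i = 0 := by omega
    by_cases hv : v = u
    · subst hv
      have hc : v' = v ∨ (w' = v ∧ G.Adj v' w') := by
        rcases h with h | h
        exacts [Or.inl h.symm, Or.inr ⟨h.1.symm, h.2⟩]
      rw [if_pos hc, if_pos rfl]
      omega
    · rw [if_neg hv]
      split_ifs <;> omega
  · split_ifs <;> omega
  · obtain rfl : i' = 0 := by omega
    by_cases hv : v' = u
    · rw [if_pos hv]; split_ifs <;> omega
    · rw [if_neg hv]
      by_cases ha : G.Adj u v'
      · rw [if_pos ha]; split_ifs <;> omega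
      · rw [if_neg ha, if_neg]
        rintro (rfl | ⟨rfl, h'⟩)
        · rcases h with h | h
          · exact hv h
          · exact ha (h.1 ▸ h.2)
        · rcases h with h | h
          · exact ha (h ▸ h'.symm)
          · exact hv h.1
  · split_ifs <;> omega
  · split_ifs <;> omega
  · split_ifs <;> omega
  · split_ifs <;> omega
  · omega

/-- The path through `mid u v` joins the outer ends of the tails of adjacent vertices. -/
theorem edist_pt_le {u v : Fin n} (h : G.Adj u v) :
    (board G b q).edist (.pt u (Fin.last b)) (.pt v (Fin.last b)) ≤ (2 * b + 2 : ℕ) := by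
  have key : ∀ (w : Fin n) (m : Vtx n b q), (∀ i, m.Linked G (.pt w i)) → m.level = q + 1 →
      ∀ (i : ℕ) (hi : i < b + 1), (board G b q).edist m (.pt w ⟨i, hi⟩) ≤ (i + 1 : ℕ) := by
    intro w m hm hl i
    induction i with
    | zero =>
      intro hi
      have : (board G b q).Adj m (.pt w ⟨0, hi⟩) := ⟨hm _, Or.inr (by rw [hl]; simp [Vtx.level])⟩
      rw [SimpleGraph.edist_eq_one_iff_adj.2 this]
      simp
    | succ i ih =>
      intro hi
      have : (board G b q).Adj (.pt w ⟨i, by omega⟩) (.pt w ⟨i + 1, hi⟩) :=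
        ⟨rfl, Or.inr (by simp [Vtx.level]; omega)⟩
      refine (SimpleGraph.edist_triangle (v := .pt w ⟨i, by omega⟩)).trans ?_
      rw [SimpleGraph.edist_eq_one_iff_adj.2 this]
      refine (add_le_add_left (ih (by omega)) 1).trans ?_
      push_cast
      exact le_rfl
  have h₁ := key u (.mid u v) (fun _ => Or.inl rfl) rfl b (by omega)
  have h₂ := key v (.mid u v) (fun _ => Or.inr ⟨rfl, h⟩) rfl b (by omega)
  rw [SimpleGraph.edist_comm] at h₁
  refine SimpleGraph.edist_triangle.trans ((add_le_add h₁ h₂).trans ?_)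
  rw [← Nat.cast_add]
  exact_mod_cast (by omega)

theorem eq_of_place_eq_some {c : Fin n → Option Player} {x : Vtx n b q} {p : Player}
    (h : place c x = some p) : (∃ u, x = .pt u (Fin.last b) ∧ c u = some p) ∨ x = base p := by
  rcases x with ⟨u, i⟩ | ⟨u, v⟩ | ⟨j, hj⟩
  · by_cases hi : i = Fin.last b
    · subst hi
      exact Or.inl ⟨u, rfl, by simpa [place] using h⟩
    · simp [place, hi] at h
  · simp [place] at h
  · right
    rcases j with _ | _ | j
    · simp only [place, if_true, Option.some.injEq] at h
      subst h; rfl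
    · simp only [place] at h
      simp only [zero_add, one_ne_zero, if_false, if_true, Option.some.injEq] at h
      subst h; rfl
    · simp [place] at h

theorem lt_edist_base (u : Fin n) (p : Player) :
    ((q + b + 1 : ℕ) : ℕ∞) < (board G b q).edist (base p) (.pt u (Fin.last b)) := by
  refine coe_lt_edist Vtx.level level_le_of_adj ?_
  cases p <;> simp [base, Vtx.level] <;> omega

/-- The translation of positions preserves and reflects legality. -/
theorem legal_place_iff (hq₁ : b + 1 ≤ q) (hq₂ : q ≤ b + 2) (c : Fin n → Option Player) :
    Legal ∅ (Set.Icc 1 (q + b + 1)) (board G b q) (place c) ↔ Legal ∅ {1} G c := by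
  rw [legal_Icc_iff, legal_singleton_iff]
  constructor
  · intro h u v p hu hv hadj
    have h₁ := h (.pt u (Fin.last b)) (.pt v (Fin.last b)) p (by simp [hadj.ne])
      (by simpa [place] using hu) (by simpa [place] using hv)
    have h₂ := h₁.trans_le (edist_pt_le (q := q) (b := b) hadj)
    have : q + b + 1 < 2 * b + 2 := by exact_mod_cast h₂
    omega
  · intro h x y p hxy hx hy
    rcases eq_of_place_eq_some hx with ⟨u, rfl, hu⟩ | rfl <;>
      rcases eq_of_place_eq_some hy with ⟨v, rfl, hv⟩ | rfl
    · refine coe_lt_edist (Vtx.far G u) (far_le_of_adj u) ?_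
      have hvu : v ≠ u := by rintro rfl; exact hxy rfl
      simp [Vtx.far, hvu, h u v p hu hv]
      omega
    · rw [SimpleGraph.edist_comm]
      exact lt_edist_base u p
    · exact lt_edist_base v p
    · exact absurd rfl hxy

/-- No player can ever move to a vertex of the new board that does not stand for a vertex of the
old board. -/
theorem eq_pt_of_legal (hq₁ : b + 1 ≤ q) {c : Fin n → Option Player} {x : Vtx n b q}
    {p : Player} (hx : place c x = none) {d : Vtx n b q → Option Player}
    (hd : Legal ∅ (Set.Icc 1 (q + b + 1)) (board G b q) d) (hdx : d x = some p)
    (hdb : d (base p) = some p) : ∃ v, x = .pt v (Fin.last b) := by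
  have hne : x ≠ base p := by
    rintro rfl
    simp [place_base] at hx
  have hlt := legal_Icc_iff.1 hd x (base p) p hne hdx hdb
  have hlev : x.level ≠ 0 := by
    intro h
    obtain ⟨p', rfl⟩ := eq_base_of_level h
    simp [place_base] at hx
  have hle := edist_base_le (G := G) (by omega) p (x.level - 1) x (by omega)
  have hlt' : q + b + 1 < x.level - 1 + 1 := by exact_mod_cast hlt.trans_le hle
  rcases x with ⟨u, i, hi⟩ | ⟨u, v⟩ | ⟨j, hj⟩
  · simp only [Vtx.level] at hlt'
    obtain rfl : i = b := by omega
    exact ⟨u, rfl⟩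
  · simp only [Vtx.level] at hlt'
    omega
  · simp only [Vtx.level] at hlt'
    omega

theorem moverWins_place (hq₁ : b + 1 ≤ q) (hq₂ : q ≤ b + 2) (p : Player)
    (c : Fin n → Option Player) :
    MoverWins ∅ {1} G p c ↔
      MoverWins ∅ (Set.Icc 1 (q + b + 1)) (board G b q) p (place c) := by
  have hupd := fun c v p => @place_update n b q (fun _ _ => Classical.propDecidable _)
    (fun _ _ => Classical.propDecidable _) c v (some p)
  refine moverWins_iff place ?_ ?_ p c
  · rintro p c d ⟨v, hv, rfl, hl⟩
    exact ⟨.pt v (Fin.last b), by simpa [place] using hv, hupd c v p,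
      (legal_place_iff hq₁ hq₂ _).2 hl⟩
  · rintro p c e ⟨x, hx, rfl, hl⟩
    have hne : base p ≠ x := by
      rintro rfl
      simp [place_base] at hx
    obtain ⟨v, rfl⟩ := eq_pt_of_legal hq₁ hx hl (@update_self _ _ (_) _ _ _)
      ((@update_of_ne _ _ (_) _ _ hne _ _).trans (place_base c p))
    rw [← hupd] at hl
    exact ⟨_, ⟨v, by simpa [place] using hx, rfl, (legal_place_iff hq₁ hq₂ _).1 hl⟩,
      (hupd c v p).symm⟩

end Board

end DistanceGame

/-! ### The reduction -/

namespace DistanceGame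

open Function StackProgram

section Enumeration

/-- The vertices of the new board, in the order in which they are numbered. -/
def vtxList (n b q : ℕ) : List (Vtx n b q) :=
  ((List.finRange n).flatMap fun u => (List.finRange (b + 1)).map (.pt u)) ++
    (((List.finRange n).flatMap fun u => (List.finRange n).map (.mid u)) ++
      (List.finRange (q + 2)).map .hub)

theorem mem_vtxList {n b q : ℕ} (x : Vtx n b q) : x ∈ vtxList n b q := by
  rcases x with ⟨u, i⟩ | ⟨u, v⟩ | j <;> simp [vtxList]

theorem nodup_vtxList (n b q : ℕ) : (vtxList n b q).Nodup := by
  have h₁ : ((List.finRange n).flatMap fun u =>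
      (List.finRange (b + 1)).map (Vtx.pt (n := n) (q := q) u)).Nodup := by
    refine List.nodup_flatMap.2 ⟨fun u _ => (List.nodup_finRange _).map fun i j h => by
      cases h; rfl, (List.nodup_finRange n).imp fun h => ?_⟩
    rintro x hx hy
    obtain ⟨i, -, rfl⟩ := List.mem_map.1 hx
    obtain ⟨j, -, e⟩ := List.mem_map.1 hy
    cases e
    exact h rfl
  have h₂ : ((List.finRange n).flatMap fun u =>
      (List.finRange n).map (Vtx.mid (b := b) (q := q) u)).Nodup := by
    refine List.nodup_flatMap.2 ⟨fun u _ => (List.nodup_finRange _).map fun i j h => by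
      cases h; rfl, (List.nodup_finRange n).imp fun h => ?_⟩
    rintro x hx hy
    obtain ⟨i, -, rfl⟩ := List.mem_map.1 hx
    obtain ⟨j, -, e⟩ := List.mem_map.1 hy
    cases e
    exact h rfl
  have h₃ : ((List.finRange (q + 2)).map (Vtx.hub (n := n) (b := b))).Nodup :=
    (List.nodup_finRange _).map fun i j h => by cases h; rfl
  refine h₁.append (h₂.append h₃ ?_) ?_
  · intro x hx hy
    simp only [List.mem_flatMap, List.mem_map] at hx hy
    obtain ⟨_, _, _, _, rfl⟩ := hx
    obtain ⟨_, _, e⟩ := hy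
    cases e
  · intro x hx hy
    simp only [List.mem_append, List.mem_flatMap, List.mem_map] at hx hy
    obtain ⟨_, _, _, _, rfl⟩ := hx
    rcases hy with ⟨_, _, _, _, e⟩ | ⟨_, _, e⟩ <;> cases e

/-- The numbering of the vertices of the new board. -/
noncomputable def vtxEquiv (n b q : ℕ) : Fin (vtxList n b q).length ≃ Vtx n b q :=
  Equiv.ofBijective (vtxList n b q).get
    ⟨List.nodup_iff_injective_get.1 (nodup_vtxList n b q),
      fun x => List.get_of_mem (mem_vtxList x)⟩

/-- The numbered board is isomorphic to the board. -/
noncomputable def boardIso {n : ℕ} (G : SimpleGraph (Fin n)) (b q : ℕ) :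
    (board G b q).comap (vtxEquiv n b q) ≃g board G b q :=
  SimpleGraph.Iso.comap (vtxEquiv n b q) (board G b q)

/-- The instance to which an instance of Col is reduced. -/
noncomputable def reduce (b q : ℕ) (hq₁ : b + 1 ≤ q) (hq₂ : q ≤ b + 2) (I : Instance ∅ {1}) :
    Instance ∅ (Set.Icc 1 (q + b + 1)) where
  n := (vtxList I.n b q).length
  graph := (board I.graph b q).comap (vtxEquiv I.n b q)
  colour := place I.colour ∘ vtxEquiv I.n b q
  legal := (legal_iso (boardIso I.graph b q) _).2 ((legal_place_iff hq₁ hq₂ _).2 I.legal)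
  turn := I.turn

theorem reduce_mem_winning_iff (b q : ℕ) (hq₁ : b + 1 ≤ q) (hq₂ : q ≤ b + 2)
    (I : Instance ∅ {1}) : reduce b q hq₁ hq₂ I ∈ winning _ _ ↔ I ∈ winning _ _ :=
  (moverWins_iso (boardIso I.graph b q) _ _).symm.trans (moverWins_place hq₁ hq₂ _ _).symm

open Classical in
theorem encode_reduce (b q : ℕ) (hq₁ : b + 1 ≤ q) (hq₂ : q ≤ b + 2) (I : Instance ∅ {1}) :
    (reduce b q hq₁ hq₂ I).encode = .turn I.turn ::
      (((vtxList I.n b q).flatMap fun x => [.cell (place I.colour x)]) ++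
        (vtxList I.n b q).flatMap fun x => (vtxList I.n b q).flatMap fun y =>
          [.entry (decide ((board I.graph b q).Adj x y))]) := by
  have key : ∀ {α β : Type} (l : List α) (f : α → β),
      (List.ofFn fun i => f (l.get i)) = l.map f := by
    intro α β l f
    conv_rhs => rw [← List.ofFn_get l, List.map_ofFn]
    rfl
  have h₁ := key (vtxList I.n b q) fun x => Letter.cell (place I.colour x)
  have h₂ := key (vtxList I.n b q) fun x => List.ofFn fun j =>
    Letter.entry (decide ((board I.graph b q).Adj x ((vtxList I.n b q).get j)))
  have h₃ := fun x => key (vtxList I.n b q) fun y =>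
    Letter.entry (decide ((board I.graph b q).Adj x y))
  refine congrArg (List.cons _) (congrArg₂ _ (h₁.trans ?_) ((congrArg List.flatten h₂).trans ?_))
  · exact List.map_eq_flatMap ..
  · simp only [h₃]
    rw [← List.flatMap_def]
    exact congrArg (fun f => List.flatMap f _) (funext fun x => List.map_eq_flatMap ..)

end Enumeration

/-! ### The program of the reduction -/

/-- The kinds of vertices of the new board. -/
inductive Role (b q : ℕ)
  | pt (i : Fin (b + 1))
  | mid
  | hub (j : Fin (q + 2))

/-- The kind of a vertex. -/
def Vtx.role {n b q : ℕ} : Vtx n b q → Role b q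
  | .pt _ i => .pt i
  | .mid _ _ => .mid
  | .hub j => .hub j

/-- The level of the vertices of a kind. -/
def Role.level {b q : ℕ} : Role b q → ℕ
  | .pt i => q + 2 + i
  | .mid => q + 1
  | .hub j => j - 1

theorem Vtx.level_role {n b q : ℕ} (x : Vtx n b q) : x.role.level = x.level := by
  cases x <;> rfl

/-- Run a program for each vertex of the new board. The vertices of the old board on which a vertex
depends are kept in the variables `x` and `y`; the body is given the kind of the vertex and, for a
tail, the cell of its vertex of the old board. -/
def forVtx (b q : ℕ) (x y : Fin 4) (P : Role b q → Letter → GProg) : GProg :=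
  .seq (forVertex x fun a => seqList ((List.finRange (b + 1)).map fun i => P (.pt i) a)) <|
  .seq (forVertex x fun a => forVertex y fun _ => P .mid a)
    (seqList ((List.finRange (q + 2)).map fun j => P (.hub j) default))

/-- The time bound for `forVtx`. -/
noncomputable def forVtxTime (b q : ℕ) (τ : Polynomial ℕ) : Polynomial ℕ :=
  Polynomial.X * (((b + 1 : ℕ) : Polynomial ℕ) * τ + 1 + 4) + 2 +
    (Polynomial.X * (Polynomial.X * (τ + 4) + 2 + 4) + 2 + (((q + 2 : ℕ) : Polynomial ℕ) * τ + 1))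

section

variable {n b q : ℕ} {c : Fin n → Letter} {M : List Letter} {env : Fin 4 → Option (Fin n)}

/-- The variables `x` and `y` hold the vertices of the old board on which a vertex depends. -/
def Reads (c : Fin n → Letter) (env : Fin 4 → Option (Fin n)) (x y : Fin 4) (a : Letter) :
    Vtx n b q → Prop
  | .pt u _ => env x = some u ∧ a = c u
  | .mid u v => env x = some u ∧ env y = some v
  | .hub _ => True

theorem computes_forVtx {x y : Fin 4} (hxy : x ≠ y) (hx : env x = none) (hy : env y = none)
    {P : Role b q → Letter → GProg} {w : Vtx n b q → List Letter} {τ : Polynomial ℕ}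
    (h : ∀ v env' a, (∀ z, z ≠ x → z ≠ y → env' z = env z) → Reads c env' x y a v →
      Computes c M env' (P v.role a) (w v) τ) :
    Computes c M env (forVtx b q x y P) ((vtxList n b q).flatMap w) (forVtxTime b q τ) := by
  have h₁ := computes_forVertex (c := c) (M := M) hx
    (P := fun a => seqList ((List.finRange (b + 1)).map fun i => P (.pt i) a))
    (w := fun u => (List.finRange (b + 1)).flatMap fun i => w (.pt u i))
    (fun u => computes_seqList _ fun i _ => h (.pt u i) _ _
      (fun z hz _ => update_of_ne hz ..) ⟨update_self .., rfl⟩)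
  have h₂ := computes_forVertex (c := c) (M := M) hx
    (P := fun a => forVertex y fun _ => P .mid a)
    (w := fun u => (List.finRange n).flatMap fun v => w (.mid u v))
    (fun u => computes_forVertex (by rw [update_of_ne hxy.symm, hy]) fun v =>
      h (.mid u v) (update (update env x (some u)) y (some v)) _
        (fun z hz hz' => by rw [update_of_ne hz', update_of_ne hz])
        ⟨by rw [update_of_ne hxy, update_self], by rw [update_self]⟩)
  have h₃ := computes_seqList (c := c) (M := M) (env := env) (List.finRange (q + 2))
    (P := fun j => P (.hub j) default) (w := fun j => w (.hub j))
    (fun j _ => h (.hub j) env _ (fun _ _ _ => rfl) trivial)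
  have e : (vtxList n b q).flatMap w =
      ((List.finRange n).flatMap fun u => (List.finRange (b + 1)).flatMap fun i => w (.pt u i)) ++
      (((List.finRange n).flatMap fun u => (List.finRange n).flatMap fun v => w (.mid u v)) ++
      (List.finRange (q + 2)).flatMap fun j => w (.hub j)) := by
    simp only [vtxList, List.flatMap_append, List.flatMap_assoc, List.flatMap_map]
  rw [e]
  exact (h₁.seq (h₂.seq h₃)).mono (by simp [forVtxTime])

/-- Write the contents of all vertices of the new board. -/
def writeCells (b q : ℕ) : GProg :=
  forVtx b q 0 1 fun r a => .push .out <|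
    match r with
    | .pt i => if i = Fin.last b then a else .cell none
    | .mid => .cell none
    | .hub j => .cell <|
      if (j : ℕ) = 0 then some .left else if (j : ℕ) = 1 then some .right else none

theorem computes_writeCells (col : Fin n → Option Player) :
    Computes (fun i => .cell (col i)) M (fun _ => none) (writeCells b q)
      ((vtxList n b q).flatMap fun x => [.cell (place col x)]) (forVtxTime b q 1) := by
  refine computes_forVtx (by decide) rfl rfl fun v env' a _ ha => ?_
  convert computes_push _ using 2
  rcases v with ⟨u, i⟩ | ⟨u, v⟩ | j
  · obtain ⟨-, rfl⟩ := ha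
    simp only [place, Vtx.role]
    split_ifs <;> rfl
  · rfl
  · rfl

/-- Write the bit that tells whether the tail of the vertex `w` is linked to `mid u v`. -/
def writeLinked (w u v : Fin 4) : GProg :=
  ifEq w u (.push .out (.entry true)) <|
    ifEq w v (ifAdj u v (.push .out (.entry true)) (.push .out (.entry false)))
      (.push .out (.entry false))

/-- The time bound for writing an entry of the matrix. -/
noncomputable def entryTime : Polynomial ℕ :=
  1 + 8 * Polynomial.X ^ 2 + 14 * Polynomial.X + 8 + 15 * Polynomial.X + 8 + 15 * Polynomial.X + 8

theorem computes_push_entry {β β' : Bool} (τ : Polynomial ℕ) (h : β = β') (hτ : 1 ≤ τ.eval n) :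
    Computes c M env (.push .out (.entry β)) [.entry β'] τ := by
  subst h
  exact (computes_push _).mono (by simpa using hτ)

variable {G : SimpleGraph (Fin n)}

open Classical in
theorem computes_writeLinked
    (hM : M = (List.ofFn fun i => List.ofFn fun j => Letter.entry (decide (G.Adj i j))).flatten)
    {x y z : Fin 4} {w u v : Fin n} (hx : env x = some w) (hy : env y = some u)
    (hz : env z = some v) {β : Bool} (hβ : β = true ↔ w = u ∨ (w = v ∧ G.Adj u v)) :
    Computes c M env (writeLinked x y z) [.entry β] entryTime := by
  obtain rfl : β = decide (w = u ∨ (w = v ∧ G.Adj u v)) := by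
    rw [Bool.eq_iff_iff, hβ, decide_eq_true_iff]
  refine computes_ifEq hx hy (fun e => ?_) fun e => computes_ifEq hx hz (fun e' =>
    computes_ifAdj hy hz hM (τ := 1) (fun ha => ?_) fun ha => ?_) fun e' => ?_
  · exact computes_push_entry _ (by simp [e]) (by simp)
  · exact computes_push_entry _ (by simp [e', of_decide_eq_true ha]) (by simp)
  · have : ¬ G.Adj u v := of_decide_eq_false ha
    exact computes_push_entry _ (by simp [e, this]) (by simp)
  · exact computes_push_entry _ (by simp [e, e']) (by simp)

/-- Write the entry of the new adjacency matrix for two vertices of given kinds. -/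
def writeEntry (r r' : Role b q) : GProg :=
  if r.level = r'.level + 1 ∨ r'.level = r.level + 1 then
    match r, r' with
    | .pt _, .pt _ => ifEq 0 2 (.push .out (.entry true)) (.push .out (.entry false))
    | .pt _, .mid => writeLinked 0 2 3
    | .mid, .pt _ => writeLinked 2 0 1
    | _, _ => .push .out (.entry true)
  else .push .out (.entry false)

open Classical in
theorem computes_writeEntry
    (hM : M = (List.ofFn fun i => List.ofFn fun j => Letter.entry (decide (G.Adj i j))).flatten)
    {x y : Vtx n b q} {a a' : Letter} (hx : Reads c env 0 1 a x) (hy : Reads c env 2 3 a' y) :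
    Computes c M env (writeEntry x.role y.role) [.entry (decide ((board G b q).Adj x y))]
      entryTime := by
  have hτ : 1 ≤ entryTime.eval n := by simp [entryTime]
  unfold writeEntry
  rw [x.level_role, y.level_role]
  by_cases hl : x.level = y.level + 1 ∨ y.level = x.level + 1
  · rw [if_pos hl]
    have e : decide ((board G b q).Adj x y) = decide (x.Linked G y) :=
      decide_eq_decide.2 (and_iff_left hl)
    rw [e]
    rcases x with ⟨u, i⟩ | ⟨u, v⟩ | j <;> rcases y with ⟨u', i'⟩ | ⟨u', v'⟩ | j'
    · refine (computes_ifEq hx.1 hy.1 (τ := 1) (fun h => ?_) fun h => ?_).mono ?_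
      · exact computes_push_entry _ (by simp [Vtx.Linked, h]) (by simp)
      · exact computes_push_entry _ (by simp [Vtx.Linked, h]) (by simp)
      · simp [entryTime]
    · exact computes_writeLinked hM hx.1 hy.1 hy.2 decide_eq_true_iff
    · exact computes_push_entry _ (decide_eq_true_iff.2 (by trivial)).symm hτ
    · exact computes_writeLinked hM hy.1 hx.1 hx.2 decide_eq_true_iff
    all_goals exact computes_push_entry _ (decide_eq_true_iff.2 (by trivial)).symm hτ
  · rw [if_neg hl]
    exact computes_push_entry _ (by simp [board, hl]) hτ

/-- Write the adjacency matrix of the new board. -/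
def writeMatrix (b q : ℕ) : GProg :=
  forVtx b q 0 1 fun r _ => forVtx b q 2 3 fun r' _ => writeEntry r r'

open Classical in
theorem computes_writeMatrix
    (hM : M = (List.ofFn fun i => List.ofFn fun j => Letter.entry (decide (G.Adj i j))).flatten) :
    Computes c M (fun _ => none) (writeMatrix b q)
      ((vtxList n b q).flatMap fun x => (vtxList n b q).flatMap fun y =>
        [.entry (decide ((board G b q).Adj x y))])
      (forVtxTime b q (forVtxTime b q entryTime)) := by
  refine computes_forVtx (by decide) rfl rfl fun x env' a henv hx => ?_
  refine computes_forVtx (by decide) (henv 2 (by decide) (by decide))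
    (henv 3 (by decide) (by decide)) fun y env'' a' henv' hy => ?_
  refine computes_writeEntry hM (a := a) ?_ hy
  have h0 := henv' 0 (by decide) (by decide)
  have h1 := henv' 1 (by decide) (by decide)
  rcases x with ⟨u, i⟩ | ⟨u, v⟩ | j
  · exact ⟨h0.trans hx.1, hx.2⟩
  · exact ⟨h0.trans hx.1, h1.trans hx.2⟩
  · trivial

end

/-- The reduction can be computed in polynomial time after any polynomial-time computation. -/
theorem reduce_comp_polyTime (b q : ℕ) (hq₁ : b + 1 ≤ q) (hq₂ : q ≤ b + 2)
    {f : List Bool → Instance ∅ {1}}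
    (hf : Turing.TM2ComputableInPolyTime (id : List Bool → List Bool) Instance.encode f) :
    Nonempty (Turing.TM2ComputableInPolyTime (id : List Bool → List Bool) Instance.encode
      (reduce b q hq₁ hq₂ ∘ f)) := by
  classical
  refine comp_program hf (reduce b q hq₁ hq₂)
    (wrap (.seq (writeCells b q) (writeMatrix b q))) .inp .res
    (3 * (forVtxTime b q 1 + forVtxTime b q (forVtxTime b q entryTime)) + 18 * Polynomial.X + 20)
    fun I => ?_
  rw [encode_reduce]
  refine exec_wrap I.colour (fun i j => decide (I.graph.Adj i j)) I.turn
    ((computes_writeCells _).seq (computes_writeMatrix (G := I.graph) ?_)) ?_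
  · congr!
  · simp only [Instance.encode]

end DistanceGame

theorem mainTheorem6
    (hCol : DistanceGame.IsPSPACEHard ∅ {1}) (k : ℕ) (hk : 1 ≤ k) :
    DistanceGame.IsPSPACEHard ∅ (Set.Icc 1 k) := by
  rcases hk.eq_or_lt with rfl | hk
  · rwa [Set.Icc_self]
  -- of the two possible values of `k` for given `b`, the even one is `2 * b + 2`
  obtain ⟨b, q, hq₁, hq₂, rfl⟩ : ∃ b q, b + 1 ≤ q ∧ q ≤ b + 2 ∧ k = q + b + 1 :=
    ⟨(k - 2) / 2, k - 1 - (k - 2) / 2, by omega, by omega, by omega⟩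
  intro L hL
  obtain ⟨f, ⟨hf⟩, hfL⟩ := hCol L hL
  exact ⟨DistanceGame.reduce b q hq₁ hq₂ ∘ f, DistanceGame.reduce_comp_polyTime b q hq₁ hq₂ hf,
    fun x => (hfL x).trans (DistanceGame.reduce_mem_winning_iff b q hq₁ hq₂ (f x)).symm⟩
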